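/- Let $T$ be a tree with $n\ge 3$ vertices and $p$ leaves (vertices of degree $1$), with degree function $d(\cdot)$ and distances $d_{x,y}$. Let $\mathrm{Max4PC}_T$ be the $\binom n2\times\binom n2$ real matrix with rows and columns indexed by the $2$-element subsets of $V(T)$ whose entry in row $\{w,x\}$ and column $\{y,z\}$ is $\max\{d_{w,x}+d_{y,z},\ d_{w,y}+d_{x,z},\ d_{w,z}+d_{x,y}\}$. The outputs $B$ of the following (nondeterministic) algorithm are sets of $2$-element subsets of $V(T)$. If $T$ is a star with centre $c$, the outputs are the sets $\{\{c,i\},\{j,k\}\}$ with $i,j,k$ leaves and $j\ne k$. If $T$ is not a star, let $G$ be the line graph $\mathrm{LG}(T)$ of $T$, whose vertices are the edges of $T$; let the starting vertex $s$ be any edge $\{a,b\}$ of $T$ with $a$ a leaf; and let $N=\emptyset$ (the set of next starting vertices) and $B=\emptyset$. Repeat the following. Let $C$ be the block of $G$ that contains $s$ (a block is a maximal connected subgraph without a cut vertex of its own). 1. If $C$ contains a cut vertex of $G$, choose such a cut vertex $c$. Add all other cut vertices of $G$ lying in $C$ to $N$. Add $s$ and the symmetric difference $s\triangle c$ to $B$.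 Replace $G$ by the graph obtained from it by removing all edges of $C$ and then deleting all vertices of $C$ that are not cut vertices of $G$. Put $s:=c$ and repeat. 2. If $C$ contains no cut vertex of $G$, choose a vertex $c\neq s$ of $C$. Add $s$ and $c$ to $B$, and delete all vertices of $C$ from $G$. If $N=\emptyset$, output $B$ and stop. Otherwise choose some $w\in N$, remove it from $N$, put $s:=w$ and repeat. Let $B$ be any output of this algorithm for $T$. Then: (a) If $T$ is not a star, there is a unique triple of vertices $(u,v,w)$ such that $\{u,v\},\{u,w\}\in B$, $d(u)=1$, $d(w)>1$, and both $\{u,v\}$ and $\{v,w\}$ are edges of $T$. (b) $|B|=2(n-p)$. (c) The rows of $\mathrm{Max4PC}_T$ indexed by $B$ form a basis of the row space of $\mathrm{Max4PC}_T$. (d) $\det \mathrm{Max4PC}_T[B,B]=(-1)^{n-p}\,2^{2(n-p-1)}$, where $\mathrm{Max4PC}_T[B,B]$ is the submatrix on the rows and columns indexed by $B$. -/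

import Mathlib

namespace Max4PC

/-- Unordered pairs of distinct elements of `V`, i.e. the 2-element subsets of `V`. -/
abbrev Pair (V : Type*) := {e : Sym2 V // ¬ e.IsDiag}

/-- The maximum 4PC matrix of `T`: the entry in row `{w,x}` and column `{y,z}` is the maximum of
`d(w,x) + d(y,z)`, `d(w,y) + d(x,z)` and `d(w,z) + d(x,y)`. -/
noncomputable def max4PC {V : Type*} (T : SimpleGraph V) : Matrix (Pair V) (Pair V) ℝ :=
  fun e f => Sym2.lift₂
    ⟨fun w x y z =>
      ((max (max (T.dist w x + T.dist y z) (T.dist w y + T.dist x z))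
        (T.dist w z + T.dist x y) : ℕ) : ℝ), by
      intro w x y z
      refine ⟨congrArg _ ?_, congrArg _ ?_⟩
      · rw [T.dist_comm (u := w) (v := x), max_right_comm, add_comm (T.dist w z),
          add_comm (T.dist w y)]
      · rw [T.dist_comm (u := y) (v := z), max_right_comm]⟩ e.1 f.1

/-- The number of leaves (vertices of degree one) of `T`. -/
def numLeaves {V : Type*} [Fintype V] (T : SimpleGraph V) [DecidableRel T.Adj] : ℕ :=
  (Finset.univ.filter fun v => T.degree v = 1).card

/-- `T` is a star. -/
def IsStar {V : Type*} (T : SimpleGraph V) : Prop := ∃ c, T = SimpleGraph.starGraph c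

/-- `v` is a cut vertex of the graph `H` (given as a subgraph of an ambient graph): deleting `v`
disconnects two other vertices that lie in the same component of `H`. -/
def IsCutVertex {W : Type*} {A : SimpleGraph W} (H : A.Subgraph) (v : W) : Prop :=
  v ∈ H.verts ∧ ∃ x y, x ≠ v ∧ y ≠ v ∧ H.spanningCoe.Reachable x y ∧
    ¬ (H.deleteVerts {v}).spanningCoe.Reachable x y

/-- A block of `H`: a maximal connected subgraph of `H` that has no cut vertex of its own. -/
def IsBlock {W : Type*} {A : SimpleGraph W} (H K : A.Subgraph) : Prop :=
  Maximal (fun K : A.Subgraph => K ≤ H ∧ K.Connected ∧ ∀ v, ¬ IsCutVertex K v) K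

/-- A vertex of the line graph of `T`, i.e. an edge of `T`, as a 2-element set of vertices. -/
def edgePair {V : Type*} {T : SimpleGraph V} (e : T.edgeSet) : Pair V :=
  ⟨e.1, T.not_isDiag_of_mem_edgeSet e.2⟩

/-- `AlgoReturns T G s N B O`: the algorithm, when it begins a round with current graph `G` (a
subgraph of the line graph of `T`), starting vertex `s`, next starting vertex set `N` and
partial output `B`, can terminate with output `O`. In each constructor `C` is the current block
and `c` the chosen vertex. -/
inductive AlgoReturns {V : Type*} (T : SimpleGraph V) :
    T.lineGraph.Subgraph → T.edgeSet → Set T.edgeSet → Set (Pair V) → Set (Pair V) → Prop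
  /-- The current block contains a cut vertex of `G`. One of them, `c`, is chosen, and the others
  are stored in the next starting vertex set. The edges of `C` and the vertices of `C` that are
  not cut vertices of `G` are deleted from `G`. The set `s` and the symmetric difference `d` of
  `s` and `c` are added to the output, and `c` becomes the starting vertex. -/
  | descend {G : T.lineGraph.Subgraph} {s : T.edgeSet} {N : Set T.edgeSet}
      {B O : Set (Pair V)} (C : T.lineGraph.Subgraph) (c : T.edgeSet) (d : Pair V)
      (hC : IsBlock G C) (hs : s ∈ C.verts)
      (hc : c ∈ C.verts) (hcut : IsCutVertex G c)
      (hd : (d.1 : Set V) = symmDiff (s.1 : Set V) (c.1 : Set V))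
      (hO : AlgoReturns T
        ((G.deleteEdges C.edgeSet).deleteVerts {x | x ∈ C.verts ∧ ¬ IsCutVertex G x})
        c
        (N ∪ {x | x ∈ C.verts ∧ IsCutVertex G x ∧ x ≠ c})
        (B ∪ {edgePair s, d}) O) :
      AlgoReturns T G s N B O
  /-- The current block contains no cut vertex of `G`. Any vertex `c ≠ s` of it is chosen, `s` and
  `c` are added to the output and the vertices of the block are deleted from `G`. An element `w`
  of the next starting vertex set is removed from that set and becomes the starting vertex. -/
  | backtrack {G : T.lineGraph.Subgraph} {s : T.edgeSet} {N : Set T.edgeSet}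
      {B O : Set (Pair V)} (C : T.lineGraph.Subgraph) (c w : T.edgeSet)
      (hC : IsBlock G C) (hs : s ∈ C.verts)
      (hcut : ∀ x ∈ C.verts, ¬ IsCutVertex G x)
      (hc : c ∈ C.verts) (hcs : c ≠ s) (hw : w ∈ N)
      (hO : AlgoReturns T (G.deleteVerts C.verts) w (N \ {w})
        (B ∪ {edgePair s, edgePair c}) O) :
      AlgoReturns T G s N B O
  /-- As in `backtrack`, but the next starting vertex set is empty: output and terminate. -/
  | halt {G : T.lineGraph.Subgraph} {s : T.edgeSet} {B : Set (Pair V)}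
      (C : T.lineGraph.Subgraph) (c : T.edgeSet)
      (hC : IsBlock G C) (hs : s ∈ C.verts)
      (hcut : ∀ x ∈ C.verts, ¬ IsCutVertex G x)
      (hc : c ∈ C.verts) (hcs : c ≠ s) :
      AlgoReturns T G s ∅ B (B ∪ {edgePair s, edgePair c})

/-- `B` is a possible output of the algorithm for the tree `T`.
For a star with centre `c` the outputs are the sets `{{c,i},{j,k}}` with `i, j, k` leaves and
`j ≠ k`. For a non-star tree the algorithm is run on the whole line graph, with a pendant edge of
`T` as starting vertex, an empty next starting vertex set and an empty partial output. -/
def IsOutput {V : Type*} [Fintype V] (T : SimpleGraph V) [DecidableRel T.Adj]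
    (B : Set (Pair V)) : Prop :=
  (∃ c i j k : V, T = SimpleGraph.starGraph c ∧
    ∃ (hci : c ≠ i) (_ : c ≠ j) (_ : c ≠ k) (hjk : j ≠ k),
      B = {⟨s(c, i), by simpa using hci⟩, ⟨s(j, k), by simpa using hjk⟩}) ∨
  (¬ IsStar T ∧ ∃ s : T.edgeSet, (∃ p ∈ s.1, T.degree p = 1) ∧ AlgoReturns T ⊤ s ∅ ∅ B)

end Max4PC

/-!
Root `T` at a leaf `a` with neighbour `b`, and give a vertex the set of its ancestors other than
the root. Distances are cardinalities of symmetric differences of such sets, and of the three sums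
in the four-point condition the largest is `|W| + |X| + |Y| + |Z|` minus twice
`|(W ∪ X) ∩ (Y ∩ Z)| + |(W ∩ X) ∩ (Y ∪ Z)|`, because ancestor sets are pairwise nested
or disjoint off common ancestors. The inner vertices lying in `W ∪ X` and in `W ∩ X` therefore
provide an integral factorization `F * D * Fᵀ` of the matrix, with `D` an orthogonal sum of
hyperbolic planes, one for each inner vertex.

The block of the line graph met by the algorithm at a starting vertex `s` is the clique of the
edges at the lower end `v` of `s`, and its cut vertices are the edges whose two ends are inner. So
an output consists, for each inner vertex `v`, of the edge from `v` to its parent and of one further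
pair joining a child of `v` to the parent of `v` or to `v` itself. The rows of `F` at these pairs
generate the integer lattice, hence form a unimodular matrix, and all claims about the rows and
the minor indexed by the output follow from the determinant of `D`.
-/

namespace Max4PC

open SimpleGraph

/-! ### Matrices that factor as `F * D * Fᵀ` -/

section Matrix

open Matrix

variable {R ι κ μ : Type*} [CommRing R] [Fintype κ]

lemma det_fromBlocks_zero_zero [DecidableEq κ] (A B : Matrix κ κ R) :
    (fromBlocks 0 A B 0).det = (-1) ^ Fintype.card κ * (A.det * B.det) := by
  let J : Matrix (κ ⊕ κ) (κ ⊕ κ) R := fromBlocks 0 1 1 0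
  let U : Matrix (κ ⊕ κ) (κ ⊕ κ) R := fromBlocks 1 1 0 1
  have hswap : U * J = fromBlocks 1 1 1 0 := by simp [U, J, fromBlocks_multiply]
  have hdet : J.det = (-1) ^ Fintype.card κ := by
    have h := congrArg det hswap
    rw [det_mul, det_fromBlocks_zero₂₁, det_fromBlocks_one₁₁] at h
    simpa [det_neg] using h
  have hmul : fromBlocks 0 A B 0 = fromBlocks A 0 0 B * J := by simp [J, fromBlocks_multiply]
  rw [hmul, det_mul, hdet, det_fromBlocks_zero₂₁, mul_comm]

lemma span_range_row_eq_top_iff_isUnit [DecidableEq κ] {K : Matrix κ κ R} :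
    Submodule.span R (Set.range K.row) = ⊤ ↔ IsUnit K := by
  rw [← range_vecMulLinear, LinearMap.range_eq_top, ← vecMul_surjective_iff_isUnit]
  rfl

lemma span_range_row_mul (F : Matrix ι κ R) (N : Matrix κ μ R) :
    Submodule.span R (Set.range (F * N).row) =
      (Submodule.span R (Set.range F.row)).map N.vecMulLinear := by
  rw [Submodule.map_span, ← Set.range_comp]
  rfl

lemma span_range_row_submatrix_mul {ρ : Type*} {F : Matrix ι κ R} {r : ρ → ι}
    (h : Submodule.span R (Set.range (F.submatrix r id).row) = ⊤) (N : Matrix κ μ R) :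
    Submodule.span R (Set.range ((F * N).submatrix r id).row) =
      Submodule.span R (Set.range (F * N).row) := by
  have hF : Submodule.span R (Set.range F.row) = ⊤ :=
    top_le_iff.1 (h ▸ Submodule.span_mono (Set.range_comp_subset_range r F.row))
  have hmul : (F * N).submatrix r id = F.submatrix r id * N := rfl
  rw [hmul, span_range_row_mul, span_range_row_mul, h, hF]

lemma exists_equiv_isUnit_submatrix [DecidableEq κ] [Nontrivial R] {F : Matrix ι κ R}
    {B : Finset ι} (hcard : B.card ≤ Fintype.card κ)
    (h : Submodule.span R (F.row '' B) = ⊤) :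
    ∃ e : κ ≃ B, IsUnit (F.submatrix (fun k => (e k).1) id) := by
  classical
  have hle : Fintype.card κ ≤ B.card := by
    have hrank := (finrank_span_finset_le_card (R := R) (B.image F.row)).trans
      Finset.card_image_le
    rwa [Finset.coe_image, Set.finrank, h, finrank_top, Module.finrank_pi] at hrank
  let e : κ ≃ B := Fintype.equivOfCardEq (by rw [Fintype.card_coe]; exact le_antisymm hle hcard)
  refine ⟨e, span_range_row_eq_top_iff_isUnit.1 ?_⟩
  rw [← h, ← Subtype.range_coe (s := (B : Set ι)), ← Set.range_comp, ← e.surjective.range_comp]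
  rfl

section Congruence

variable [DecidableEq κ] {F : Matrix ι κ R} {B : Finset ι} {e : κ ≃ B}

lemma det_submatrix_mul_mul_transpose (F : Matrix ι κ R) [DecidableEq ι] (D : Matrix κ κ R)
    (e : κ ≃ B) :
    ((F * D * Fᵀ).submatrix (fun i : B => i.1) fun i : B => i.1).det =
      (F.submatrix (fun k => (e k).1) id).det ^ 2 * D.det := by
  have h : ((F * D * Fᵀ).submatrix (fun i : B => i.1) fun i : B => i.1).submatrix e e =
      F.submatrix (fun k => (e k).1) id * D * (F.submatrix (fun k => (e k).1) id)ᵀ := rfl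
  rw [← det_submatrix_equiv_self e, h, det_mul, det_mul, det_transpose]
  ring

lemma linearIndependent_row_mul_mul_transpose [IsDomain R] {D : Matrix κ κ R} (hD : D.det ≠ 0)
    (h : IsUnit (F.submatrix (fun k => (e k).1) id)) :
    LinearIndependent R fun i : B => (F * D * Fᵀ).row i.1 := by
  classical
  refine LinearIndependent.of_comp (LinearMap.funLeft R R fun i : B => i.1)
    (linearIndependent_rows_of_det_ne_zero
      (A := (F * D * Fᵀ).submatrix (fun i : B => i.1) fun i : B => i.1) ?_)
  rw [det_submatrix_mul_mul_transpose F D e]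
  exact mul_ne_zero (pow_ne_zero _ ((isUnit_iff_isUnit_det _).1 h).ne_zero) hD

lemma span_range_row_mul_of_isUnit (h : IsUnit (F.submatrix (fun k => (e k).1) id))
    (N : Matrix κ μ R) :
    Submodule.span R (Set.range fun i : B => (F * N).row i.1) =
      Submodule.span R (Set.range (F * N).row) := by
  rw [← span_range_row_submatrix_mul (span_range_row_eq_top_iff_isUnit.2 h),
    ← e.surjective.range_comp]
  rfl

end Congruence

lemma mul_fromBlocks_diagonal_mul_transpose_apply [DecidableEq κ] (F : Matrix ι (κ ⊕ κ) R)
    (c : κ → R) (i j : ι) :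
    (F * fromBlocks 0 (diagonal c) (diagonal c) 0 * Fᵀ) i j =
      ∑ k, c k * (F i (.inl k) * F j (.inr k) + F i (.inr k) * F j (.inl k)) := by
  simp only [mul_apply, Fintype.sum_sum_type, fromBlocks_apply₁₁, fromBlocks_apply₁₂,
    fromBlocks_apply₂₁, fromBlocks_apply₂₂, Matrix.zero_apply, diagonal_apply, mul_ite, mul_zero,
    Finset.sum_ite_eq', Finset.mem_univ, if_true, zero_add, add_zero,
    transpose_apply, ← Finset.sum_add_distrib]
  exact Finset.sum_congr rfl fun k _ => by ring

end Matrix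

/-! ### Rooted trees -/

section Parent

variable {V : Type*} {T : SimpleGraph V} {a u v x : V}

open Classical in
/-- The neighbour of `v` on the way to the root `a`. The root is its own parent. -/
noncomputable def parent (T : SimpleGraph V) (a v : V) : V :=
  if h : ∃ u, T.Adj u v ∧ T.dist a v = T.dist a u + 1 then h.choose else v

@[simp]
lemma parent_root : parent T a a = a := by
  rw [parent, dif_neg]
  rintro ⟨u, -, h⟩
  simp at h

lemma exists_adj_dist_eq_dist_add_one (hT : T.Connected) (hv : v ≠ a) :
    ∃ u, T.Adj u v ∧ T.dist a v = T.dist a u + 1 := by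
  obtain ⟨p, hp⟩ := hT.exists_walk_length_eq_dist a v
  have hnil : ¬ p.Nil := fun h => hv h.eq.symm
  have hadj := p.adj_penultimate hnil
  refine ⟨p.penultimate, hadj, le_antisymm ?_ ?_⟩
  · rw [← dist_eq_one_iff_adj.2 hadj]
    exact hT.dist_triangle
  · rw [← hp, ← Walk.length_dropLast_add_one hnil]
    exact Nat.succ_le_succ (dist_le _)

lemma adj_parent (hT : T.Connected) (hv : v ≠ a) : T.Adj (parent T a v) v := by
  have h := exists_adj_dist_eq_dist_add_one hT hv
  rw [parent, dif_pos h]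
  exact h.choose_spec.1

lemma parent_ne (hT : T.Connected) (hv : v ≠ a) : parent T a v ≠ v :=
  (adj_parent hT hv).ne

lemma dist_eq_dist_parent_add_one (hT : T.Connected) (hv : v ≠ a) :
    T.dist a v = T.dist a (parent T a v) + 1 := by
  have h := exists_adj_dist_eq_dist_add_one hT hv
  rw [parent, dif_pos h]
  exact h.choose_spec.2

lemma parent_induction (hT : T.Connected) {P : V → Prop} (root : P a)
    (step : ∀ v, v ≠ a → P (parent T a v) → P v) (v : V) : P v := by
  induction hk : T.dist a v generalizing v with
  | zero => rwa [← hT.dist_eq_zero_iff.1 hk]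
  | succ k ih =>
    have hv : v ≠ a := by
      rintro rfl
      simp at hk
    have h := dist_eq_dist_parent_add_one hT hv
    exact step v hv (ih _ (by omega))

lemma eq_of_adj_of_dist_eq_dist_add_one (hT : T.IsTree) (hu : T.Adj u v) (hx : T.Adj x v)
    (hdu : T.dist a v = T.dist a u + 1) (hdx : T.dist a v = T.dist a x + 1) : u = x := by
  obtain ⟨p, hp⟩ := hT.1.exists_walk_length_eq_dist a u
  obtain ⟨q, hq⟩ := hT.1.exists_walk_length_eq_dist a x
  have hpu : (p.concat hu).IsPath := Walk.isPath_of_length_eq_dist _ (by simp [hp, hdu])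
  have hqx : (q.concat hx).IsPath := Walk.isPath_of_length_eq_dist _ (by simp [hq, hdx])
  simpa using congrArg Walk.penultimate ((hT.existsUnique_path a v).unique hpu hqx)

lemma eq_parent_of_adj_of_dist_eq (hT : T.IsTree) (h : T.Adj u v)
    (hd : T.dist a v = T.dist a u + 1) : v ≠ a ∧ u = parent T a v := by
  have hv : v ≠ a := by
    rintro rfl
    simp at hd
  exact ⟨hv, eq_of_adj_of_dist_eq_dist_add_one hT h (adj_parent hT.1 hv) hd
    (dist_eq_dist_parent_add_one hT.1 hv)⟩

lemma eq_parent_or_eq_parent_of_adj (hT : T.IsTree) (a : V) (h : T.Adj u v) :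
    (v ≠ a ∧ u = parent T a v) ∨ (u ≠ a ∧ v = parent T a u) :=
  (hT.dist_eq_dist_add_one_of_adj a h).symm.imp (eq_parent_of_adj_of_dist_eq hT h)
    (eq_parent_of_adj_of_dist_eq hT h.symm)

end Parent

/-! ### Ancestors and the four-point maximum -/

section Overlap

open Finset

variable {V : Type*} [DecidableEq V]

/-- The excess over two of the number of the sets `W`, `X`, `Y`, `Z` containing an element, added
up over all elements contained in at least two of them. -/
def overlap (W X Y Z : Finset V) : ℕ :=
  #((W ∪ X) ∩ (Y ∩ Z)) + #((W ∩ X) ∩ (Y ∪ Z))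

/-- The elements that separate `{W, X}` from `{Y, Z}`: they lie in both sets of one of these pairs
and in no set of the other. -/
def splitting (W X Y Z : Finset V) : Finset V :=
  (W ∩ X) \ (Y ∪ Z) ∪ (Y ∩ Z) \ (W ∪ X)

lemma overlap_swap_middle (W X Y Z : Finset V) : overlap W Y X Z = overlap W X Y Z := by
  rw [overlap, overlap, ← card_union_add_card_inter, ← card_union_add_card_inter ((W ∪ X) ∩ _)]
  congr 2 <;> · ext v; simp only [mem_union, mem_inter]; tauto

lemma overlap_swap_right (W X Y Z : Finset V) : overlap W X Z Y = overlap W X Y Z := by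
  rw [overlap, overlap, inter_comm Z, union_comm Z]

lemma card_inter_add_card_inter (W X Y Z : Finset V) :
    #(W ∩ X) + #(Y ∩ Z) = overlap W X Y Z + #(splitting W X Y Z) := by
  have hdisj : Disjoint ((W ∩ X) \ (Y ∪ Z)) ((Y ∩ Z) \ (W ∪ X)) := by
    refine disjoint_left.2 fun v hv hv' => ?_
    simp only [mem_sdiff, mem_inter, mem_union] at hv hv'
    tauto
  have h₁ := card_inter_add_card_sdiff (W ∩ X) (Y ∪ Z)
  have h₂ := card_inter_add_card_sdiff (Y ∩ Z) (W ∪ X)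
  rw [inter_comm (Y ∩ Z)] at h₂
  rw [overlap, splitting, card_union_of_disjoint hdisj]
  omega

end Overlap

section Ancestors

open Finset

variable {V : Type*} [Fintype V] [DecidableEq V] {T : SimpleGraph V} {a u v x y : V}

/-- The vertices other than the root `a` on the path from `a` to `x`, including `x` itself. They
stand for the edges of that path, so that their number is the depth of `x`. -/
noncomputable def ancestors (T : SimpleGraph V) (a x : V) : Finset V :=
  univ.filter fun v => v ≠ a ∧ T.dist a v + T.dist v x = T.dist a x

lemma mem_ancestors : v ∈ ancestors T a x ↔ v ≠ a ∧ T.dist a v + T.dist v x = T.dist a x := by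
  simp [ancestors]

lemma self_mem_ancestors (hx : x ≠ a) : x ∈ ancestors T a x := by
  simp [mem_ancestors, hx]

lemma ancestors_root (hT : T.Connected) : ancestors T a a = ∅ := by
  ext v
  simp [mem_ancestors, hT.dist_eq_zero_iff, eq_comm]

lemma ancestors_subset (hT : T.Connected) (h : u ∈ ancestors T a v) :
    ancestors T a u ⊆ ancestors T a v := by
  intro x hx
  rw [mem_ancestors] at h hx ⊢
  have h₁ : T.dist x v ≤ T.dist x u + T.dist u v := hT.dist_triangle
  have h₂ : T.dist a v ≤ T.dist a x + T.dist x v := hT.dist_triangle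
  exact ⟨hx.1, by omega⟩

lemma notMem_ancestors_parent (hT : T.Connected) (hx : x ≠ a) :
    x ∉ ancestors T a (parent T a x) := by
  rw [mem_ancestors]
  have h := dist_eq_dist_parent_add_one hT hx
  omega

lemma ancestors_eq_insert (hT : T.IsTree) (hx : x ≠ a) :
    ancestors T a x = insert x (ancestors T a (parent T a x)) := by
  have hd := dist_eq_dist_parent_add_one hT.1 hx
  have hadj := dist_eq_one_iff_adj.2 (adj_parent hT.1 hx)
  ext v
  rw [mem_insert]
  constructor
  · intro hv
    refine or_iff_not_imp_left.2 fun hvx => ?_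
    rw [mem_ancestors] at hv ⊢
    have hvd := dist_eq_dist_parent_add_one hT.1 (Ne.symm hvx)
    rcases eq_parent_or_eq_parent_of_adj hT a (adj_parent hT.1 (Ne.symm hvx)) with
      ⟨-, h⟩ | ⟨h, h'⟩
    · rw [h] at hvd
      exact ⟨hv.1, by omega⟩
    · have h₁ := dist_eq_dist_parent_add_one hT.1 h
      have h₂ : T.dist a (parent T v x) ≤ T.dist a v + T.dist v (parent T v x) :=
        hT.1.dist_triangle
      rw [← h'] at h₁
      omega
  · rintro (rfl | hv)
    · exact self_mem_ancestors hx
    · rw [mem_ancestors] at hv ⊢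
      have h₁ : T.dist v x ≤ T.dist v (parent T a x) + T.dist (parent T a x) x :=
        hT.1.dist_triangle
      have h₂ : T.dist a x ≤ T.dist a v + T.dist v x := hT.1.dist_triangle
      exact ⟨hv.1, by omega⟩

lemma ancestors_parent_subset (hT : T.IsTree) (a x : V) :
    ancestors T a (parent T a x) ⊆ ancestors T a x := by
  rcases eq_or_ne x a with rfl | hx
  · rw [parent_root]
  · rw [ancestors_eq_insert hT hx]
    exact subset_insert _ _

lemma mem_ancestors_or_mem_ancestors (hT : T.IsTree) (hu : u ∈ ancestors T a x)
    (hv : v ∈ ancestors T a x) : u ∈ ancestors T a v ∨ v ∈ ancestors T a u := by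
  induction x using parent_induction (a := a) hT.1 with
  | root => simp [ancestors_root hT.1] at hu
  | step x hx ih =>
    have hux := hu
    rw [ancestors_eq_insert hT hx, mem_insert] at hu hv
    rcases hu with rfl | hu
    · rcases hv with rfl | hv
      · exact Or.inl hux
      · exact Or.inr (ancestors_eq_insert hT hx ▸ mem_insert_of_mem hv)
    · rcases hv with rfl | hv
      · exact Or.inl hux
      · exact ih hu hv

lemma card_ancestors (hT : T.IsTree) (x : V) : #(ancestors T a x) = T.dist a x := by
  induction x using parent_induction (a := a) hT.1 with
  | root => simp [ancestors_root hT.1]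
  | step x hx ih =>
    rw [ancestors_eq_insert hT hx, card_insert_of_notMem (notMem_ancestors_parent hT.1 hx), ih,
      dist_eq_dist_parent_add_one hT.1 hx]

lemma mem_ancestors_of_dist_parent_eq (hT : T.IsTree) (hx : x ≠ a)
    (h : T.dist y (parent T a x) = T.dist x y + 1) : x ∈ ancestors T a y := by
  induction y using parent_induction (a := x) hT.1 with
  | root => exact self_mem_ancestors hx
  | step y hy ih =>
    set z := parent T x y with hz
    have hzy : T.Adj z y := adj_parent hT.1 hy
    have hd : T.dist x y = T.dist x z + 1 := dist_eq_dist_parent_add_one hT.1 hy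
    have hxz : x ∈ ancestors T a z := by
      have hyz := dist_eq_one_iff_adj.2 hzy.symm
      have hxp := dist_eq_one_iff_adj.2 (adj_parent hT.1 hx).symm
      have h₁ : T.dist y (parent T a x) ≤ T.dist y z + T.dist z (parent T a x) :=
        hT.1.dist_triangle
      have h₂ : T.dist z (parent T a x) ≤ T.dist z x + T.dist x (parent T a x) :=
        hT.1.dist_triangle
      rw [dist_comm (u := z) (v := x)] at h₂
      exact ih (by omega)
    rcases eq_parent_or_eq_parent_of_adj hT a hzy with ⟨hya, hzy'⟩ | ⟨hza, hyz⟩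
    · rw [ancestors_eq_insert hT hya, ← hzy']
      exact mem_insert_of_mem hxz
    · rw [ancestors_eq_insert hT hza, ← hyz, mem_insert] at hxz
      refine hxz.resolve_left fun hxz => ?_
      rw [hxz, ← hyz] at h
      simp at h

lemma dist_add_two_mul_card_inter_ancestors (hT : T.IsTree) (a x y : V) :
    T.dist x y + 2 * #(ancestors T a x ∩ ancestors T a y) = T.dist a x + T.dist a y := by
  induction x using parent_induction (a := a) hT.1 with
  | root => simp [ancestors_root hT.1]
  | step x hx ih =>
    by_cases hxy : x ∈ ancestors T a y
    · rw [inter_eq_left.2 (ancestors_subset hT.1 hxy), card_ancestors hT]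
      have := (mem_ancestors.1 hxy).2
      omega
    · rw [ancestors_eq_insert hT hx, insert_inter_of_notMem hxy]
      have hd := dist_eq_dist_parent_add_one hT.1 hx
      have hxy' := mt (mem_ancestors_of_dist_parent_eq (y := y) hT hx) hxy
      have h := hT.dist_eq_dist_add_one_of_adj y (adj_parent hT.1 hx)
      rw [dist_comm, dist_comm (v := x)] at h
      rw [dist_comm] at hxy'
      omega

lemma splitting_ancestors_eq_empty_or (hT : T.IsTree) (a w x y z : V) :
    splitting (ancestors T a w) (ancestors T a x) (ancestors T a y) (ancestors T a z) = ∅ ∨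
      splitting (ancestors T a w) (ancestors T a y) (ancestors T a x) (ancestors T a z) = ∅ := by
  by_contra! hne
  obtain ⟨⟨u, hu⟩, ⟨v, hv⟩⟩ := hne
  have hnested (t : V) (hut : u ∈ ancestors T a t) (hvt : v ∈ ancestors T a t) :
      (∀ s, v ∈ ancestors T a s → u ∈ ancestors T a s) ∨
        (∀ s, u ∈ ancestors T a s → v ∈ ancestors T a s) :=
    (mem_ancestors_or_mem_ancestors hT hut hvt).imp (fun h _ hs => ancestors_subset hT.1 hs h)
      (fun h _ hs => ancestors_subset hT.1 hs h)
  simp only [splitting, mem_union, mem_sdiff, mem_inter, not_or] at hu hv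
  grind

lemma max_dist_add_dist_add_overlap (hT : T.IsTree) (a w x y z : V) :
    max (max (T.dist w x + T.dist y z) (T.dist w y + T.dist x z)) (T.dist w z + T.dist x y) +
        2 * overlap (ancestors T a w) (ancestors T a x) (ancestors T a y) (ancestors T a z) =
      T.dist a w + T.dist a x + (T.dist a y + T.dist a z) := by
  have hdist := dist_add_two_mul_card_inter_ancestors hT a
  have h₁ := card_inter_add_card_inter (ancestors T a w) (ancestors T a x)
    (ancestors T a y) (ancestors T a z)
  have h₂ := card_inter_add_card_inter (ancestors T a w) (ancestors T a y)
    (ancestors T a x) (ancestors T a z)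
  have h₃ := card_inter_add_card_inter (ancestors T a w) (ancestors T a z)
    (ancestors T a x) (ancestors T a y)
  rw [overlap_swap_middle] at h₂
  rw [overlap_swap_middle, overlap_swap_right] at h₃
  have hwx := hdist w x
  have hyz := hdist y z
  have hwy := hdist w y
  have hxz := hdist x z
  have hwz := hdist w z
  have hxy := hdist x y
  rcases splitting_ancestors_eq_empty_or hT a w x y z with h | h <;>
    · rw [← card_eq_zero] at h
      omega

end Ancestors

/-! ### The factorization of `max4PC T` -/

section Degree

variable {V : Type*} [Fintype V] {T : SimpleGraph V} [DecidableRel T.Adj] {a v x y : V}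

lemma eq_of_degree_eq_one (hv : T.degree v = 1) (hx : T.Adj v x) (hy : T.Adj v y) : x = y := by
  rw [← T.mem_neighborFinset] at hx hy
  exact Finset.card_le_one.1 hv.le x hx y hy

lemma one_lt_degree_parent (hT : T.Connected) (hv : v ≠ a) (hp : parent T a v ≠ a) :
    1 < T.degree (parent T a v) := by
  refine Finset.one_lt_card.2 ⟨v, ?_, parent T a (parent T a v), ?_, ?_⟩
  · simpa using adj_parent hT hv
  · simpa using (adj_parent hT hp).symm
  · intro h
    have h₁ := dist_eq_dist_parent_add_one hT hv
    have h₂ := dist_eq_dist_parent_add_one hT hp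
    rw [← h] at h₂
    omega

lemma parent_eq_root_or_one_lt_degree (hT : T.Connected) (hv : v ≠ a) :
    parent T a v = a ∨ 1 < T.degree (parent T a v) :=
  or_iff_not_imp_left.2 (one_lt_degree_parent hT hv)

end Degree

section Features

open Finset

variable {V : Type*} [Fintype V] [DecidableEq V] {T : SimpleGraph V} {a b v x : V}

/-- The union of the ancestor sets of the two elements of a pair. -/
noncomputable def joinAncestors (T : SimpleGraph V) (a : V) (S : Pair V) : Finset V :=
  Sym2.lift ⟨fun x y => ancestors T a x ∪ ancestors T a y, fun _ _ => union_comm _ _⟩ S.1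

/-- The common ancestors of the two elements of a pair. -/
noncomputable def meetAncestors (T : SimpleGraph V) (a : V) (S : Pair V) : Finset V :=
  Sym2.lift ⟨fun x y => ancestors T a x ∩ ancestors T a y, fun _ _ => inter_comm _ _⟩ S.1

/-- The sum of the depths of the two elements of a pair. -/
noncomputable def totalDepth (T : SimpleGraph V) (a : V) (S : Pair V) : ℕ :=
  Sym2.lift ⟨fun x y => T.dist a x + T.dist a y, fun _ _ => add_comm _ _⟩ S.1

lemma max4PC_add_card_inter (hT : T.IsTree) (a : V) (S S' : Pair V) :
    max4PC T S S' + 2 * (#(joinAncestors T a S ∩ meetAncestors T a S') +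
        #(meetAncestors T a S ∩ joinAncestors T a S')) =
      totalDepth T a S + totalDepth T a S' := by
  obtain ⟨⟨w, x⟩, hwx⟩ := S
  obtain ⟨⟨y, z⟩, hyz⟩ := S'
  have h := max_dist_add_dist_add_overlap hT a w x y z
  simp only [← Nat.cast_inj (R := ℝ), overlap, Nat.cast_add, Nat.cast_mul] at h
  simpa [max4PC, joinAncestors, meetAncestors, totalDepth] using h

variable [DecidableRel T.Adj]

lemma one_lt_degree_of_mem_ancestors (hT : T.IsTree) (hvx : v ∈ ancestors T a x) (hne : v ≠ x) :
    1 < T.degree v := by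
  induction x using parent_induction (a := a) hT.1 with
  | root => simp [ancestors_root hT.1] at hvx
  | step x hx ih =>
    rw [ancestors_eq_insert hT hx, mem_insert] at hvx
    have hvp := hvx.resolve_left hne
    by_cases hp : v = parent T a x
    · exact hp ▸ one_lt_degree_parent hT.1 hx (hp ▸ (mem_ancestors.1 hvp).1)
    · exact ih hvp hp

lemma one_lt_degree_of_mem_meetAncestors (hT : T.IsTree) {S : Pair V}
    (hv : v ∈ meetAncestors T a S) : 1 < T.degree v := by
  obtain ⟨⟨x, y⟩, hxy⟩ := S
  have hne : x ≠ y := by simpa using hxy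
  obtain ⟨hvx, hvy⟩ := mem_inter.1 hv
  rcases eq_or_ne v x with rfl | h
  · exact one_lt_degree_of_mem_ancestors hT hvy hne
  · exact one_lt_degree_of_mem_ancestors hT hvx h

/-- A pendant edge `ab` with leaf `a`, at which the tree is rooted. -/
structure IsPendantEdge (T : SimpleGraph V) [DecidableRel T.Adj] (a b : V) : Prop where
  adj : T.Adj a b
  degree_eq_one : T.degree a = 1
  one_lt_degree : 1 < T.degree b

/-- The vertices of degree at least two. -/
abbrev Inner (T : SimpleGraph V) [DecidableRel T.Adj] := {v : V // 1 < T.degree v}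

lemma IsPendantEdge.mem_ancestors (hT : T.IsTree) (h : IsPendantEdge T a b) (hx : x ≠ a) :
    b ∈ ancestors T a x := by
  induction x using parent_induction (a := a) hT.1 with
  | root => exact absurd rfl hx
  | step x hx' ih =>
    by_cases hp : parent T a x = a
    · rw [eq_of_degree_eq_one h.degree_eq_one h.adj (hp ▸ adj_parent hT.1 hx')]
      exact self_mem_ancestors hx
    · exact ancestors_eq_insert hT hx' ▸ mem_insert_of_mem (ih hp)

lemma IsPendantEdge.mem_joinAncestors (hT : T.IsTree) (h : IsPendantEdge T a b) (S : Pair V) :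
    b ∈ joinAncestors T a S := by
  obtain ⟨⟨x, y⟩, hxy⟩ := S
  have hne : x ≠ y := by simpa using hxy
  rcases eq_or_ne x a with rfl | hx
  · exact mem_union_right _ (h.mem_ancestors hT hne.symm)
  · exact mem_union_left _ (h.mem_ancestors hT hx)

/-- The coordinates of a pair in which `max4PC T` becomes a sum of hyperbolic planes. The root edge
`ab` separates the root from every other vertex, so its first coordinate is constantly `1` and
its plane can absorb the summand `totalDepth`. -/
noncomputable def feature (T : SimpleGraph V) [DecidableRel T.Adj] (a b : V) :
    Matrix (Pair V) (Inner T ⊕ Inner T) ℤ := fun S =>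
  Sum.elim (fun v => if v.1 ∈ joinAncestors T a S then 1 else 0) fun v =>
    if v.1 = b then totalDepth T a S - 2 * (if b ∈ meetAncestors T a S then 1 else 0)
    else if v.1 ∈ meetAncestors T a S then 1 else 0

/-- The Gram matrix of the sum of hyperbolic planes. -/
def planeMatrix (T : SimpleGraph V) [DecidableRel T.Adj] (b : V) :
    Matrix (Inner T ⊕ Inner T) (Inner T ⊕ Inner T) ℤ :=
  let c (v : Inner T) : ℤ := if v.1 = b then 1 else -2
  Matrix.fromBlocks 0 (Matrix.diagonal c) (Matrix.diagonal c) 0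

lemma sum_inner_boole_mul_boole {s t : Finset V} (h : ∀ v ∈ s ∩ t, 1 < T.degree v) :
    ∑ v : Inner T, ((if v.1 ∈ s then 1 else 0) * (if v.1 ∈ t then 1 else 0) : ℤ) = #(s ∩ t) := by
  simp only [ite_zero_mul_ite_zero, ← mem_inter, mul_one]
  rw [sum_boole, ← card_map (Function.Embedding.subtype _)]
  congr 2
  ext v
  simpa [and_assoc] using fun hs ht => h v (mem_inter.2 ⟨hs, ht⟩)

lemma max4PC_eq_map_feature (hT : T.IsTree) (h : IsPendantEdge T a b) :
    max4PC T = (feature T a b * planeMatrix T b * (feature T a b).transpose).map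
      (Int.castRingHom ℝ) := by
  ext S S'
  have hS : ∀ v ∈ joinAncestors T a S ∩ meetAncestors T a S', 1 < T.degree v := fun v hv =>
    one_lt_degree_of_mem_meetAncestors hT (mem_inter.1 hv).2
  have hS' : ∀ v ∈ meetAncestors T a S ∩ joinAncestors T a S', 1 < T.degree v := fun v hv =>
    one_lt_degree_of_mem_meetAncestors hT (mem_inter.1 hv).1
  have hsum : (feature T a b * planeMatrix T b * (feature T a b).transpose) S S' =
      totalDepth T a S + totalDepth T a S' -
        2 * (#(joinAncestors T a S ∩ meetAncestors T a S') +
          #(meetAncestors T a S ∩ joinAncestors T a S')) := by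
    rw [planeMatrix, mul_fromBlocks_diagonal_mul_transpose_apply,
      ← sum_inner_boole_mul_boole hS, ← sum_inner_boole_mul_boole hS', ← sum_add_distrib,
      mul_sum, ← Fintype.sum_ite_eq (⟨b, h.one_lt_degree⟩ : Inner T)
        fun _ => (totalDepth T a S + totalDepth T a S' : ℤ), ← sum_sub_distrib]
    refine sum_congr rfl fun v _ => ?_
    rcases eq_or_ne v ⟨b, h.one_lt_degree⟩ with rfl | hv
    · simp only [feature, Sum.elim_inl, Sum.elim_inr, h.mem_joinAncestors hT, if_true]
      ring
    · have hvb : v.1 ≠ b := fun hvb => hv (Subtype.ext hvb)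
      simp only [feature, Sum.elim_inl, Sum.elim_inr, if_neg hvb, if_neg hv.symm]
      ring
  have hmax := max4PC_add_card_inter hT a S S'
  rw [Matrix.map_apply, hsum, eq_intCast]
  push_cast
  linarith

end Features

section Unimodular

open Finset

variable {V : Type*} [Fintype V] {T : SimpleGraph V} [DecidableRel T.Adj] {a b : V}

lemma card_inner [Nontrivial V] (hT : T.Connected) :
    (Fintype.card (Inner T) : ℤ) = Fintype.card V - numLeaves T := by
  have hleaf (v : V) : ¬ 1 < T.degree v ↔ T.degree v = 1 := by
    have := hT.preconnected.degree_pos_of_nontrivial v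
    omega
  have hsplit := card_filter_add_card_filter_not (s := (univ : Finset V)) fun v => 1 < T.degree v
  simp only [hleaf, card_univ] at hsplit
  rw [Fintype.card_subtype, numLeaves]
  omega

variable [DecidableEq V]

lemma det_planeMatrix (hb : 1 < T.degree b) :
    (planeMatrix T b).det =
      (-1) ^ Fintype.card (Inner T) * 2 ^ (2 * (Fintype.card (Inner T) - 1)) := by
  have hprod : ∏ v : Inner T, (if v.1 = b then 1 else -2 : ℤ) =
      (-2) ^ (Fintype.card (Inner T) - 1) := by
    rw [← mul_prod_erase univ _ (mem_univ ⟨b, hb⟩), if_pos rfl, one_mul,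
      prod_congr rfl fun v hv => if_neg fun hvb => ne_of_mem_erase hv (Subtype.ext hvb),
      prod_const, card_erase_of_mem (mem_univ _), card_univ]
  rw [planeMatrix, det_fromBlocks_zero_zero, Matrix.det_diagonal, hprod, ← mul_pow, pow_mul]
  norm_num

/-- The rows of `feature` at the pairs in `B` form a unimodular matrix. -/
def HasUnimodularFeatures (T : SimpleGraph V) [DecidableRel T.Adj] (a b : V)
    (B : Finset (Pair V)) : Prop :=
  ∃ e : Inner T ⊕ Inner T ≃ B, IsUnit ((feature T a b).submatrix (fun k => (e k).1) id)

lemma max4PC_eq_mul_mul_transpose (hT : T.IsTree) (h : IsPendantEdge T a b) :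
    max4PC T = (feature T a b).map (Int.castRingHom ℝ) *
      (planeMatrix T b).map (Int.castRingHom ℝ) *
      ((feature T a b).map (Int.castRingHom ℝ)).transpose := by
  rw [max4PC_eq_map_feature hT h, Matrix.map_mul, Matrix.map_mul, Matrix.transpose_map]

namespace HasUnimodularFeatures

variable {B : Finset (Pair V)}

lemma card_eq [Nontrivial V] (hT : T.Connected) (hB : HasUnimodularFeatures T a b B) :
    (#B : ℤ) = 2 * ((Fintype.card V : ℤ) - (numLeaves T : ℤ)) := by
  obtain ⟨e, -⟩ := hB
  rw [← card_inner hT, ← Fintype.card_coe, ← Fintype.card_congr e, Fintype.card_sum, ← two_mul,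
    Nat.cast_mul, Nat.cast_two]

lemma linearIndependent_row (hT : T.IsTree) (h : IsPendantEdge T a b)
    (hB : HasUnimodularFeatures T a b B) :
    LinearIndependent ℝ fun i : B => (max4PC T).row i.1 := by
  obtain ⟨e, he⟩ := hB
  rw [max4PC_eq_mul_mul_transpose hT h]
  have hunit := he.map (Int.castRingHom ℝ).mapMatrix
  rw [RingHom.mapMatrix_apply, ← Matrix.submatrix_map] at hunit
  refine linearIndependent_row_mul_mul_transpose ?_ hunit
  rw [← RingHom.mapMatrix_apply, ← RingHom.map_det, det_planeMatrix h.one_lt_degree]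
  simp

lemma span_row_eq (hT : T.IsTree) (h : IsPendantEdge T a b)
    (hB : HasUnimodularFeatures T a b B) :
    Submodule.span ℝ (Set.range fun i : B => (max4PC T).row i.1) =
      Submodule.span ℝ (Set.range (max4PC T).row) := by
  obtain ⟨e, he⟩ := hB
  rw [max4PC_eq_mul_mul_transpose hT h, Matrix.mul_assoc]
  have hunit := he.map (Int.castRingHom ℝ).mapMatrix
  rw [RingHom.mapMatrix_apply, ← Matrix.submatrix_map] at hunit
  exact span_range_row_mul_of_isUnit hunit _

lemma det_submatrix [Nontrivial V] (hT : T.IsTree) (h : IsPendantEdge T a b)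
    (hB : HasUnimodularFeatures T a b B) :
    ((max4PC T).submatrix (fun i : B => i.1) fun i : B => i.1).det =
      (-1) ^ ((Fintype.card V : ℤ) - (numLeaves T : ℤ)) *
        2 ^ (2 * ((Fintype.card V : ℤ) - (numLeaves T : ℤ) - 1)) := by
  have hpos : 1 ≤ Fintype.card (Inner T) := Fintype.card_pos_iff.2 ⟨⟨b, h.one_lt_degree⟩⟩
  obtain ⟨e, he⟩ := hB
  have hsq := Int.isUnit_sq ((Matrix.isUnit_iff_isUnit_det _).1 he)
  rw [max4PC_eq_map_feature hT h, Matrix.submatrix_map, ← RingHom.mapMatrix_apply,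
    ← RingHom.map_det, det_submatrix_mul_mul_transpose _ _ e, hsq, one_mul,
    det_planeMatrix h.one_lt_degree, ← card_inner hT.1, ← Nat.cast_one, ← Nat.cast_sub hpos]
  norm_cast

end HasUnimodularFeatures

end Unimodular

/-! ### Generators of the feature lattice -/

section Lattice

variable {V : Type*} [Fintype V] {T : SimpleGraph V} [DecidableRel T.Adj] {a b l v x y : V}

namespace IsPendantEdge

lemma ne_root (h : IsPendantEdge T a b) (hv : 1 < T.degree v) : v ≠ a := by
  rintro rfl
  exact hv.ne' h.degree_eq_one

lemma eq_of_parent_eq_root (hT : T.Connected) (h : IsPendantEdge T a b) (hv : v ≠ a)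
    (hp : parent T a v = a) : v = b :=
  eq_of_degree_eq_one h.degree_eq_one (hp ▸ adj_parent hT hv) h.adj

lemma parent_eq_root (hT : T.IsTree) (h : IsPendantEdge T a b) : parent T a b = a := by
  rcases eq_parent_or_eq_parent_of_adj hT a h.adj with ⟨-, hp⟩ | ⟨ha, -⟩
  · exact hp.symm
  · exact absurd rfl ha

lemma parent_eq_base (hT : T.Connected) (h : IsPendantEdge T a b)
    (hinner : ∀ v, 1 < T.degree v → v = b) (hxa : x ≠ a) (hxb : x ≠ b) : parent T a x = b :=
  hinner _ ((parent_eq_root_or_one_lt_degree hT hxa).resolve_left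
    (mt (h.eq_of_parent_eq_root hT hxa) hxb))

end IsPendantEdge

/-- `S` is a possible second pair for `v`, next to the edge from `v` to its parent: it consists of
the parent of `v` and an inner child of `v` or, if `v` has no inner child, of `v` and a child. -/
def IsSecondPair (T : SimpleGraph V) [DecidableRel T.Adj] (a v : V) (S : Pair V) : Prop :=
  (∃ w, 1 < T.degree w ∧ parent T a w = v ∧ S.1 = s(parent T a v, w)) ∨
    (∀ w, 1 < T.degree w → parent T a w ≠ v) ∧ ∃ l, l ≠ a ∧ parent T a l = v ∧ S.1 = s(v, l)

/-- `P` consists, for every vertex in `R`, of the edge to its parent and of a second pair. -/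
def IsPairSystem (T : SimpleGraph V) [DecidableRel T.Adj] (a : V) (R : Set V)
    (P : Set (Pair V)) : Prop :=
  ∃ t : V → Pair V, (∀ v ∈ R, IsSecondPair T a v (t v)) ∧
    P = {S | ∃ v ∈ R, S.1 = s(parent T a v, v) ∨ S = t v}

lemma IsPairSystem.card_le {B : Finset (Pair V)}
    (hB : IsPairSystem T a {v | 1 < T.degree v} B) : B.card ≤ Fintype.card (Inner T ⊕ Inner T) := by
  classical
  obtain ⟨t, -, hBt⟩ := hB
  let pairs : Inner T ⊕ Inner T → Sym2 V := Sum.elim (fun v => s(parent T a v, v)) fun v => (t v).1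
  have hsubset : B.map (Function.Embedding.subtype _) ⊆ Finset.univ.image pairs := by
    intro e he
    obtain ⟨S, hS, rfl⟩ := Finset.mem_map.1 he
    rw [← Finset.mem_coe, hBt] at hS
    obtain ⟨v, hv, hS | hS⟩ := hS
    · exact Finset.mem_image.2 ⟨.inl ⟨v, hv⟩, Finset.mem_univ _, hS.symm⟩
    · exact Finset.mem_image.2 ⟨.inr ⟨v, hv⟩, Finset.mem_univ _, by rw [hS]; rfl⟩
  rw [← Finset.card_map (Function.Embedding.subtype _)]
  exact (Finset.card_le_card hsubset).trans Finset.card_image_le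

variable [DecidableEq V]

/-- The part of the feature of a pair that comes from the lower of two nested vertices. -/
noncomputable def lowerFeature (T : SimpleGraph V) [DecidableRel T.Adj] (a b y : V) :
    Inner T ⊕ Inner T → ℤ :=
  Sum.elim (fun v => if v.1 ∈ ancestors T a y then 1 else 0) fun v =>
    if v.1 = b then T.dist a y else 0

/-- The part of the feature of a pair that comes from the upper of two nested vertices. -/
noncomputable def upperFeature (T : SimpleGraph V) [DecidableRel T.Adj] (a b x : V) :
    Inner T ⊕ Inner T → ℤ :=
  Sum.elim 0 fun v =>
    if v.1 = b then T.dist a x - 2 * (if b ∈ ancestors T a x then 1 else 0)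
    else if v.1 ∈ ancestors T a x then 1 else 0

lemma feature_eq_lowerFeature_add_upperFeature {S : Pair V} (hS : S.1 = s(x, y))
    (h : ancestors T a x ⊆ ancestors T a y) :
    feature T a b S = lowerFeature T a b y + upperFeature T a b x := by
  have hjoin : joinAncestors T a S = ancestors T a y := by
    simp [joinAncestors, hS, Finset.union_eq_right.2 h]
  have hmeet : meetAncestors T a S = ancestors T a x := by
    simp [meetAncestors, hS, Finset.inter_eq_left.2 h]
  have hdepth : totalDepth T a S = T.dist a x + T.dist a y := by simp [totalDepth, hS]
  funext k
  rcases k with v | v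
  · simp [feature, lowerFeature, upperFeature, hjoin]
  · rcases eq_or_ne v.1 b with hv | hv
    · simp only [feature, lowerFeature, upperFeature, hmeet, hdepth, Pi.add_apply, Sum.elim_inr,
        if_pos hv]
      push_cast
      ring
    · simp [feature, lowerFeature, upperFeature, hmeet, hv]

lemma lowerFeature_root (hT : T.Connected) : lowerFeature T a b a = 0 := by
  funext k
  rcases k with v | v <;> simp [lowerFeature, ancestors_root hT]

lemma upperFeature_root (hT : T.Connected) : upperFeature T a b a = 0 := by
  funext k
  rcases k with v | v <;> simp [upperFeature, ancestors_root hT]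

lemma lowerFeature_of_inner (hT : T.IsTree) (h : IsPendantEdge T a b) (v : Inner T) :
    lowerFeature T a b v = lowerFeature T a b (parent T a v) + Pi.single (.inl v) 1 +
      Pi.single (.inr ⟨b, h.one_lt_degree⟩) 1 := by
  have hv := h.ne_root v.2
  have hvp := notMem_ancestors_parent hT.1 hv
  funext k
  rcases k with u | u
  · rcases eq_or_ne u v with rfl | hu
    · simp [lowerFeature, hvp, self_mem_ancestors hv]
    · simp [lowerFeature, ancestors_eq_insert hT hv, hu, Subtype.coe_inj]
  · simp [lowerFeature, dist_eq_dist_parent_add_one hT.1 hv, Pi.single_apply, Subtype.ext_iff,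
      ite_add_ite]

lemma lowerFeature_of_leaf (hT : T.IsTree) (h : IsPendantEdge T a b) (hl : l ≠ a)
    (hleaf : ¬ 1 < T.degree l) :
    lowerFeature T a b l = lowerFeature T a b (parent T a l) +
      Pi.single (.inr ⟨b, h.one_lt_degree⟩) 1 := by
  funext k
  rcases k with u | u
  · have hul : u.1 ≠ l := fun hul => hleaf (hul ▸ u.2)
    simp [lowerFeature, ancestors_eq_insert hT hl, hul]
  · simp [lowerFeature, dist_eq_dist_parent_add_one hT.1 hl, Pi.single_apply, Subtype.ext_iff,
      ite_add_ite]

lemma upperFeature_base (hT : T.IsTree) (h : IsPendantEdge T a b) :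
    upperFeature T a b b = -Pi.single (.inr ⟨b, h.one_lt_degree⟩) 1 := by
  have hb := h.ne_root h.one_lt_degree
  have hanc : ancestors T a b = {b} := by
    rw [ancestors_eq_insert hT hb, h.parent_eq_root hT, ancestors_root hT.1]
    rfl
  funext k
  rcases k with u | u
  · simp [upperFeature]
  · rcases eq_or_ne u ⟨b, h.one_lt_degree⟩ with rfl | hu
    · simp [upperFeature, hanc, dist_eq_one_iff_adj.2 h.adj]
    · have hub : u.1 ≠ b := fun hub => hu (Subtype.ext hub)
      simp [upperFeature, hanc, hu, hub]

lemma upperFeature_of_inner (hT : T.IsTree) (h : IsPendantEdge T a b) (v : Inner T)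
    (hvb : v.1 ≠ b) :
    upperFeature T a b v = upperFeature T a b (parent T a v) + Pi.single (.inr v) 1 +
      Pi.single (.inr ⟨b, h.one_lt_degree⟩) 1 := by
  have hv := h.ne_root v.2
  have hvp := notMem_ancestors_parent hT.1 hv
  funext k
  rcases k with u | u
  · simp [upperFeature]
  · rcases eq_or_ne u v with rfl | huv
    · simp [upperFeature, hvp, self_mem_ancestors hv, hvb, Subtype.ext_iff]
    · rcases eq_or_ne u ⟨b, h.one_lt_degree⟩ with rfl | hu
      · simp [upperFeature, ancestors_eq_insert hT hv, dist_eq_dist_parent_add_one hT.1 hv, huv,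
          Ne.symm hvb]
        ring
      · have hub : u.1 ≠ b := fun hub => hu (Subtype.ext hub)
        simp [upperFeature, ancestors_eq_insert hT hv, huv, hu, hub, Subtype.coe_inj]

lemma eq_top_of_upperFeature_sub_mem (hT : T.IsTree) (h : IsPendantEdge T a b)
    {W : Submodule ℤ (Inner T ⊕ Inner T → ℤ)}
    (hedge : ∀ v, 1 < T.degree v → lowerFeature T a b v + upperFeature T a b (parent T a v) ∈ W)
    (hsub : ∀ v, 1 < T.degree v → upperFeature T a b v - upperFeature T a b (parent T a v) ∈ W) :
    W = ⊤ := by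
  have hbase : Pi.single (.inr ⟨b, h.one_lt_degree⟩) 1 ∈ W := by
    simpa [h.parent_eq_root hT, upperFeature_root hT.1, upperFeature_base hT h] using
      hsub b h.one_lt_degree
  have hupper (x : V) (hx : x = a ∨ 1 < T.degree x) : upperFeature T a b x ∈ W := by
    induction x using parent_induction (a := a) hT.1 with
    | root =>
      rw [upperFeature_root hT.1]
      exact W.zero_mem
    | step v hv ih =>
      exact (W.sub_mem_iff_left (ih (parent_eq_root_or_one_lt_degree hT.1 hv))).1
        (hsub v (hx.resolve_left hv))
  have hlower (x : V) (hx : x = a ∨ 1 < T.degree x) : lowerFeature T a b x ∈ W := by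
    rcases hx with rfl | hx
    · rw [lowerFeature_root hT.1]
      exact W.zero_mem
    · exact (W.add_mem_iff_left
        (hupper _ (parent_eq_root_or_one_lt_degree hT.1 (h.ne_root hx)))).1 (hedge x hx)
  rw [← top_le_iff, ← (Pi.basisFun ℤ _).span_eq, Submodule.span_le]
  rintro - ⟨v | v, rfl⟩ <;> rw [Pi.basisFun_apply, SetLike.mem_coe]
  · have hmem := hlower v (.inr v.2)
    rw [lowerFeature_of_inner hT h, W.add_mem_iff_left hbase] at hmem
    exact (W.add_mem_iff_right
      (hlower _ (parent_eq_root_or_one_lt_degree hT.1 (h.ne_root v.2)))).1 hmem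
  · rcases eq_or_ne v ⟨b, h.one_lt_degree⟩ with rfl | hv
    · exact hbase
    · have hmem := hsub v v.2
      rwa [upperFeature_of_inner hT h v fun hvb => hv (Subtype.ext hvb), add_assoc,
        add_sub_cancel_left, W.add_mem_iff_left hbase] at hmem

lemma upperFeature_sub_mem_of_isSecondPair (hT : T.IsTree) (h : IsPendantEdge T a b)
    (hchild : ∃ w, 1 < T.degree w ∧ parent T a w = b) {W : Submodule ℤ (Inner T ⊕ Inner T → ℤ)}
    {t : V → Pair V} (ht : ∀ v, 1 < T.degree v → IsSecondPair T a v (t v))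
    (hedge : ∀ v, 1 < T.degree v → lowerFeature T a b v + upperFeature T a b (parent T a v) ∈ W)
    (hsecond : ∀ v, 1 < T.degree v → feature T a b (t v) ∈ W) (hv : 1 < T.degree v) :
    upperFeature T a b v - upperFeature T a b (parent T a v) ∈ W := by
  have hparent (w : V) : ancestors T a (parent T a w) ⊆ ancestors T a w :=
    ancestors_parent_subset hT a w
  have hinner {v w : V} (hv : 1 < T.degree v) (hw : 1 < T.degree w) (hwv : parent T a w = v)
      (htv : (t v).1 = s(parent T a v, w)) :
      upperFeature T a b v - upperFeature T a b (parent T a v) ∈ W := by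
    have hfeature := feature_eq_lowerFeature_add_upperFeature (b := b) htv
      ((hparent v).trans (hwv ▸ hparent w))
    have hmem := W.sub_mem (hedge w hw) (hsecond v hv)
    rwa [hwv, hfeature, add_sub_add_left_eq_sub] at hmem
  have hbase : Pi.single (.inr ⟨b, h.one_lt_degree⟩) 1 ∈ W := by
    rcases ht b h.one_lt_degree with ⟨w, hw, hwb, htb⟩ | ⟨hno, -⟩
    · have hmem := hinner h.one_lt_degree hw hwb htb
      rwa [h.parent_eq_root hT, upperFeature_root hT.1, upperFeature_base hT h, sub_zero,
        neg_mem_iff] at hmem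
    · obtain ⟨w, hw, hwb⟩ := hchild
      exact absurd hwb (hno w hw)
  rcases ht v hv with ⟨w, hw, hwv, htv⟩ | ⟨hno, l, hl, hlv, htv⟩
  · exact hinner hv hw hwv htv
  · have hfeature := feature_eq_lowerFeature_add_upperFeature (b := b) htv (hlv ▸ hparent l)
    have hmem := W.sub_mem (hsecond v hv) (hedge v hv)
    rwa [hfeature, lowerFeature_of_leaf hT h hl fun hdeg => hno l hdeg hlv, hlv, add_assoc,
      add_sub_add_left_eq_sub, add_sub_assoc, W.add_mem_iff_right hbase] at hmem

lemma IsPairSystem.span_feature_eq_top (hT : T.IsTree) (h : IsPendantEdge T a b)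
    (hchild : ∃ w, 1 < T.degree w ∧ parent T a w = b) {B : Set (Pair V)}
    (hB : IsPairSystem T a {v | 1 < T.degree v} B) :
    Submodule.span ℤ (feature T a b '' B) = ⊤ := by
  obtain ⟨t, ht, hBt⟩ := hB
  have hedge (v : V) (hv : 1 < T.degree v) :
      lowerFeature T a b v + upperFeature T a b (parent T a v) ∈
        Submodule.span ℤ (feature T a b '' B) := by
    have hne : ¬ s(parent T a v, v).IsDiag := by simpa using parent_ne hT.1 (h.ne_root hv)
    have hmem : (⟨_, hne⟩ : Pair V) ∈ B := hBt ▸ ⟨v, hv, .inl rfl⟩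
    rw [← feature_eq_lowerFeature_add_upperFeature (S := ⟨_, hne⟩) rfl
      (ancestors_parent_subset hT a v)]
    exact Submodule.subset_span ⟨_, hmem, rfl⟩
  have hsecond (v : V) (hv : 1 < T.degree v) :
      feature T a b (t v) ∈ Submodule.span ℤ (feature T a b '' B) :=
    Submodule.subset_span ⟨t v, hBt ▸ ⟨v, hv, .inr rfl⟩, rfl⟩
  exact eq_top_of_upperFeature_sub_mem hT h hedge fun v hv =>
    upperFeature_sub_mem_of_isSecondPair hT h hchild ht hedge hsecond hv

lemma IsPairSystem.hasUnimodularFeatures (hT : T.IsTree) (h : IsPendantEdge T a b)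
    (hchild : ∃ w, 1 < T.degree w ∧ parent T a w = b) {B : Finset (Pair V)}
    (hB : IsPairSystem T a {v | 1 < T.degree v} B) : HasUnimodularFeatures T a b B :=
  exists_equiv_isUnit_submatrix hB.card_le (hB.span_feature_eq_top hT h hchild)

end Lattice

section Star

variable {V : Type*} [Fintype V] {c j k x : V}

lemma eq_center_of_one_lt_degree_starGraph [DecidableRel (starGraph c).Adj]
    (hx : 1 < (starGraph c).degree x) : x = c := by
  classical
  by_contra hne
  exact hx.ne' (by convert degree_starGraph_of_ne_center hne)

lemma isPendantEdge_starGraph [DecidableRel (starGraph c).Adj] (hcj : c ≠ j) (hck : c ≠ k)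
    (hjk : j ≠ k) : IsPendantEdge (starGraph c) j c where
  adj := starGraph_center_adj' hcj
  degree_eq_one := by
    classical
    convert degree_starGraph_of_ne_center hcj.symm
  one_lt_degree := Finset.one_lt_card.2 ⟨j, by simpa using hcj, k, by simpa using hck, hjk⟩

variable [DecidableEq V] {T : SimpleGraph V} [DecidableRel T.Adj] {a b i : V}

lemma feature_eq_lowerFeature_of_forall_inner_eq (hT : T.IsTree) (h : IsPendantEdge T a b)
    (hinner : ∀ v, 1 < T.degree v → v = b) (hxb : x ≠ b) {S : Pair V} (hS : S.1 = s(b, x)) :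
    feature T a b S = lowerFeature T a b b := by
  rcases eq_or_ne x a with rfl | hxa
  · rw [feature_eq_lowerFeature_add_upperFeature (hS.trans Sym2.eq_swap)
      (by simp [ancestors_root hT.1]), upperFeature_root hT.1, add_zero]
  · have hp := h.parent_eq_base hT.1 hinner hxa hxb
    have hsub := ancestors_parent_subset hT a x
    rw [hp] at hsub
    rw [feature_eq_lowerFeature_add_upperFeature hS hsub,
      lowerFeature_of_leaf hT h hxa (mt (hinner x) hxb), hp, upperFeature_base hT h,
      add_neg_cancel_right]

lemma hasUnimodularFeatures_of_forall_inner_eq (hT : T.IsTree) (h : IsPendantEdge T a b)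
    (hinner : ∀ v, 1 < T.degree v → v = b) {S S' : Pair V} (hib : i ≠ b) (hS : S.1 = s(b, i))
    (hka : k ≠ a) (hkb : k ≠ b) (hS' : S'.1 = s(a, k)) :
    HasUnimodularFeatures T a b {S, S'} := by
  have hb : 0 < Fintype.card (Inner T) := Fintype.card_pos_iff.2 ⟨⟨b, h.one_lt_degree⟩⟩
  refine exists_equiv_isUnit_submatrix
    (Finset.card_le_two.trans (by rw [Fintype.card_sum]; omega)) ?_
  have hFS := feature_eq_lowerFeature_of_forall_inner_eq hT h hinner hib hS
  have hFS' : feature T a b S' =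
      lowerFeature T a b b + Pi.single (.inr ⟨b, h.one_lt_degree⟩) 1 := by
    rw [feature_eq_lowerFeature_add_upperFeature hS' (by simp [ancestors_root hT.1]),
      lowerFeature_of_leaf hT h hka (mt (hinner k) hkb), h.parent_eq_base hT.1 hinner hka hkb,
      upperFeature_root hT.1, add_zero]
  set W := Submodule.span ℤ ((feature T a b).row '' ({S, S'} : Finset (Pair V)))
  have hmem : feature T a b S ∈ W := Submodule.subset_span ⟨S, by simp, rfl⟩
  have hmem' : feature T a b S' ∈ W := Submodule.subset_span ⟨S', by simp, rfl⟩
  rw [hFS] at hmem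
  rw [hFS', W.add_mem_iff_right hmem] at hmem'
  refine eq_top_of_upperFeature_sub_mem hT h (fun v hv => ?_) fun v hv => ?_ <;>
    rw [hinner v hv, h.parent_eq_root hT, upperFeature_root hT.1]
  · rwa [add_zero]
  · rw [upperFeature_base hT h, sub_zero]
    exact W.neg_mem hmem'

end Star

/-! ### Blocks of the line graph -/

lemma not_isCutVertex_of_pairwise_adj {W : Type*} {A : SimpleGraph W} {H : A.Subgraph} {e : W}
    (he : (H.neighborSet e).Pairwise H.Adj) : ¬ IsCutVertex H e := by
  rintro ⟨-, x, y, hx, hy, hreach, hnot⟩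
  have hstep {f g : W} (hf : f ≠ e) (hg : g ≠ e) (h : H.Adj f g) :
      (H.deleteVerts {e}).spanningCoe.Reachable f g :=
    Adj.reachable (Subgraph.deleteVerts_adj.2 ⟨H.edge_vert h, hf, H.edge_vert h.symm, hg, h⟩)
  -- A walk that enters `e` can skip it, because the neighbours of `e` are adjacent to each other.
  suffices hinv : (y ≠ e → (H.deleteVerts {e}).spanningCoe.Reachable x y) ∧
      (y = e → ∀ z, H.Adj e z → (H.deleteVerts {e}).spanningCoe.Reachable x z) from
    hnot (hinv.1 hy)
  clear hnot hy
  rw [reachable_iff_reflTransGen] at hreach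
  induction hreach with
  | refl => exact ⟨fun _ => Reachable.refl _, fun h => absurd h hx⟩
  | @tail f g _ hfg ih =>
    replace hfg : H.Adj f g := hfg
    rcases eq_or_ne f e with rfl | hf
    · exact ⟨fun _ => ih.2 rfl g hfg, fun h => absurd h hfg.ne.symm⟩
    refine ⟨fun hg => (ih.1 hf).trans (hstep hf hg hfg), ?_⟩
    rintro rfl z hz
    rcases eq_or_ne f z with rfl | hfz
    · exact ih.1 hf
    · exact (ih.1 hf).trans (hstep hf hz.ne.symm (he hfg.symm hz hfz))

lemma deleteVerts_verts_deleteEdges_edgeSet {W : Type*} {A : SimpleGraph W} (H K : A.Subgraph) :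
    (H.deleteEdges K.edgeSet).deleteVerts K.verts = H.deleteVerts K.verts := by
  refine Subgraph.ext rfl (funext₂ fun e f => propext ?_)
  rw [Subgraph.deleteVerts_adj, Subgraph.deleteVerts_adj, Subgraph.deleteEdges_adj,
    Subgraph.mem_edgeSet]
  exact ⟨fun ⟨he, he', hf, hf', h, _⟩ => ⟨he, he', hf, hf', h⟩,
    fun ⟨he, he', hf, hf', h⟩ => ⟨he, he', hf, hf', h, fun hK => he' (K.edge_vert hK)⟩⟩

section CliqueUnion

variable {V : Type*} {T : SimpleGraph V} {R : Set V} {e f g : T.edgeSet} {v w : V}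

/-- The subgraph of the line graph formed by the cliques of edges at the vertices in `R`. The
current graph of the algorithm always has this form, with `R` the set of inner vertices whose
clique has not been processed. -/
def cliqueUnion (T : SimpleGraph V) (R : Set V) : T.lineGraph.Subgraph where
  verts := {e | ∃ v ∈ R, v ∈ e.1}
  Adj e f := e ≠ f ∧ ∃ v ∈ R, v ∈ e.1 ∧ v ∈ f.1
  adj_sub := by
    rintro e f ⟨hne, v, -, he, hf⟩
    exact lineGraph_adj_iff_exists.2 ⟨hne, v, he, hf⟩
  edge_vert := by
    rintro e f ⟨-, v, hv, he, -⟩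
    exact ⟨v, hv, he⟩
  symm := ⟨by
    rintro e f ⟨hne, v, hv, he, hf⟩
    exact ⟨hne.symm, v, hv, hf, he⟩⟩

lemma cliqueUnion_mono {R' : Set V} (h : R ⊆ R') : cliqueUnion T R ≤ cliqueUnion T R' :=
  ⟨fun _ ⟨v, hv, he⟩ => ⟨v, h hv, he⟩, fun _ _ ⟨hne, v, hv, he⟩ => ⟨hne, v, h hv, he⟩⟩

lemma mem_cliqueUnion_singleton : e ∈ (cliqueUnion T {v}).verts ↔ v ∈ e.1 :=
  ⟨by rintro ⟨u, rfl, h⟩; exact h, fun h => ⟨v, rfl, h⟩⟩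

lemma edge_eq_mk_of_mem (hv : v ∈ e.1) (hw : w ∈ e.1) (hne : v ≠ w) : e.1 = s(v, w) :=
  (Sym2.mem_and_mem_iff hne).1 ⟨hv, hw⟩

lemma exists_edge_eq_mk (hv : v ∈ e.1) : ∃ w, T.Adj v w ∧ e.1 = s(v, w) := by
  obtain ⟨w, hw⟩ := hv
  exact ⟨w, T.mem_edgeSet.1 (hw ▸ e.2), hw⟩

lemma edge_eq_of_mem (hne : v ≠ w) (hv : v ∈ e.1) (hw : w ∈ e.1) (hv' : v ∈ f.1)
    (hw' : w ∈ f.1) : e = f :=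
  Subtype.ext ((edge_eq_mk_of_mem hv hw hne).trans (edge_eq_mk_of_mem hv' hw' hne).symm)

lemma not_reachable_deleteVerts (hT : T.IsAcyclic) (H : T.lineGraph.Subgraph)
    (he : e.1 = s(v, w)) (hfe : f ≠ e) (hv : v ∈ f.1) (hw : w ∈ g.1) :
    ¬ (H.deleteVerts {e}).spanningCoe.Reachable f g := by
  intro hreach
  have hbridge := isAcyclic_iff_forall_isBridge.1 hT e.2
  rw [he, isBridge_iff] at hbridge
  have hends {k : T.edgeSet} (hk : k ≠ e) {x y : V} (hx : x ∈ k.1) (hy : y ∈ k.1) :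
      (T.deleteEdges {s(v, w)}).Reachable x y := by
    rcases eq_or_ne x y with rfl | hxy
    · rfl
    have hkxy := edge_eq_mk_of_mem hx hy hxy
    refine Adj.reachable (deleteEdges_adj.2 ⟨T.mem_edgeSet.1 (hkxy ▸ k.2), fun h => hk ?_⟩)
    exact Subtype.ext (hkxy.trans (h.trans he.symm))
  suffices hinv : ∀ x ∈ g.1, (T.deleteEdges {s(v, w)}).Reachable v x from hbridge (hinv w hw)
  clear hw
  rw [reachable_iff_reflTransGen] at hreach
  induction hreach with
  | refl => exact fun x hx => hends hfe hv hx
  | @tail k l _ hkl ih =>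
    intro x hx
    obtain ⟨-, -, -, hl, hadj⟩ := Subgraph.deleteVerts_adj.1 hkl
    obtain ⟨-, y, hyk, hyl⟩ := lineGraph_adj_iff_exists.1 (H.adj_sub hadj)
    exact (ih y hyk).trans (hends hl hyl hx)

lemma mem_of_isCutVertex_cliqueUnion (he : IsCutVertex (cliqueUnion T R) e) (hw : w ∈ e.1) :
    w ∈ R := by
  by_contra hwR
  obtain ⟨v, hvR, hve⟩ := he.1
  have honly {u : V} (huR : u ∈ R) (hue : u ∈ e.1) : u = v := by
    rw [edge_eq_mk_of_mem hve hw (ne_of_mem_of_not_mem hvR hwR), Sym2.mem_iff] at hue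
    exact hue.resolve_right (ne_of_mem_of_not_mem huR hwR)
  refine not_isCutVertex_of_pairwise_adj ?_ he
  rintro f ⟨-, x, hxR, hxe, hxf⟩ g ⟨-, y, hyR, hye, hyg⟩ hfg
  exact ⟨hfg, v, hvR, honly hxR hxe ▸ hxf, honly hyR hye ▸ hyg⟩

variable [T.LocallyFinite]

lemma exists_adj_ne_of_one_lt_degree (hv : 1 < T.degree v) (w : V) : ∃ x, T.Adj v x ∧ x ≠ w := by
  obtain ⟨x, hx, hxw⟩ := Finset.exists_mem_ne hv w
  exact ⟨x, (T.mem_neighborFinset v x).1 hx, hxw⟩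

lemma isCutVertex_cliqueUnion (hT : T.IsAcyclic) (hR : ∀ v ∈ R, 1 < T.degree v)
    (he : ∀ v ∈ e.1, v ∈ R) : IsCutVertex (cliqueUnion T R) e := by
  obtain ⟨⟨v, w⟩, hvw⟩ := e
  change T.Adj v w at hvw
  have hv : v ∈ R := he v (Sym2.mem_mk_left v w)
  have hw : w ∈ R := he w (Sym2.mem_mk_right v w)
  obtain ⟨x, hx, hxw⟩ := exists_adj_ne_of_one_lt_degree (hR v hv) w
  obtain ⟨y, hy, hyv⟩ := exists_adj_ne_of_one_lt_degree (hR w hw) v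
  have hne : (⟨s(v, x), hx⟩ : T.edgeSet) ≠ ⟨s(v, w), hvw⟩ := fun h =>
    hxw (Sym2.congr_right.1 (congrArg Subtype.val h))
  have hne' : (⟨s(w, y), hy⟩ : T.edgeSet) ≠ ⟨s(v, w), hvw⟩ := fun h =>
    hyv (Sym2.congr_right.1 ((congrArg Subtype.val h).trans Sym2.eq_swap))
  refine ⟨⟨v, hv, Sym2.mem_mk_left _ _⟩, ⟨s(v, x), hx⟩, ⟨s(w, y), hy⟩, hne, hne', ?_, ?_⟩
  · refine Reachable.trans (v := ⟨s(v, w), hvw⟩) (Adj.reachable ?_) (Adj.reachable ?_)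
    · exact ⟨hne, v, hv, Sym2.mem_mk_left _ _, Sym2.mem_mk_left _ _⟩
    · exact ⟨hne'.symm, w, hw, Sym2.mem_mk_right _ _, Sym2.mem_mk_left _ _⟩
  · exact not_reachable_deleteVerts hT _ rfl hne (Sym2.mem_mk_left _ _) (Sym2.mem_mk_left _ _)

lemma isCutVertex_cliqueUnion_iff (hT : T.IsAcyclic) (hR : ∀ v ∈ R, 1 < T.degree v) :
    IsCutVertex (cliqueUnion T R) e ↔ ∀ v ∈ e.1, v ∈ R :=
  ⟨fun he _ => mem_of_isCutVertex_cliqueUnion he, isCutVertex_cliqueUnion hT hR⟩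

end CliqueUnion

section Block

variable {V : Type*} {T : SimpleGraph V} {R : Set V} {C : T.lineGraph.Subgraph}
  {e f s : T.edgeSet} {v x : V}

lemma cliqueUnion_singleton_connected (he : v ∈ e.1) : (cliqueUnion T {v}).Connected := by
  refine Subgraph.connected_iff.2
    ⟨Subgraph.preconnected_iff.2 ?_, ⟨e, mem_cliqueUnion_singleton.2 he⟩⟩
  rintro ⟨f, hf⟩ ⟨g, hg⟩
  rcases eq_or_ne f g with rfl | hfg
  · rfl
  · exact Adj.reachable
      ⟨hfg, v, rfl, mem_cliqueUnion_singleton.1 hf, mem_cliqueUnion_singleton.1 hg⟩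

lemma not_isCutVertex_cliqueUnion_singleton : ¬ IsCutVertex (cliqueUnion T {v}) e := by
  intro he
  obtain ⟨⟨x, y⟩, hxy⟩ := e
  have hx : x ∈ ({v} : Set V) := mem_of_isCutVertex_cliqueUnion he (Sym2.mem_mk_left x y)
  have hy : y ∈ ({v} : Set V) := mem_of_isCutVertex_cliqueUnion he (Sym2.mem_mk_right x y)
  exact (T.mem_edgeSet.1 hxy).ne (hx.trans hy.symm)

lemma mem_of_mem_verts_of_le_cliqueUnion (hT : T.IsAcyclic) (hle : C ≤ cliqueUnion T R)
    (hconn : C.Connected) (hcut : ∀ e, ¬ IsCutVertex C e) (hs : s ∈ C.verts)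
    (hsv : s.1 = s(x, v)) (hx : x ∉ R) (hf : f ∈ C.verts) : v ∈ f.1 := by
  have hvs : v ∈ s.1 := hsv ▸ Sym2.mem_mk_right _ _
  have hreach : C.spanningCoe.Reachable s f :=
    (Subgraph.preconnected_iff.1 hconn.preconnected ⟨s, hs⟩ ⟨f, hf⟩).map
      C.coeEmbeddingSpanningCoe.toHom
  clear hf
  rw [reachable_iff_reflTransGen] at hreach
  induction hreach with
  | refl => exact hvs
  | @tail g g' hg hgg' ih =>
    replace hgg' : C.Adj g g' := hgg'
    obtain ⟨hne, y, hyR, hyg, hyg'⟩ := hle.2 hgg'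
    by_contra hvg'
    have hvy : v ≠ y := fun h => hvg' (h ▸ hyg')
    have hsg : s ≠ g := by
      rintro rfl
      rw [hsv, Sym2.mem_iff] at hyg
      exact hyg.elim (ne_of_mem_of_not_mem hyR hx) hvy.symm
    -- Leaving the clique at `v` through `g = {v, y}` makes `g` a cut vertex of the block.
    refine hcut g ⟨C.edge_vert hgg', s, g', hsg, hne.symm, ?_,
      not_reachable_deleteVerts hT C (edge_eq_mk_of_mem ih hyg hvy) hsg hvs hyg'⟩
    exact reachable_iff_reflTransGen _ _ |>.2 (hg.tail hgg')

lemma IsBlock.eq_cliqueUnion_singleton (hT : T.IsAcyclic) (hC : IsBlock (cliqueUnion T R) C)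
    (hs : s ∈ C.verts) (hsv : s.1 = s(x, v)) (hv : v ∈ R) (hx : x ∉ R) :
    C = cliqueUnion T {v} := by
  obtain ⟨⟨hle, hconn, hcut⟩, hmax⟩ := hC
  have hmem : ∀ f ∈ C.verts, v ∈ f.1 := fun f =>
    mem_of_mem_verts_of_le_cliqueUnion hT hle hconn hcut hs hsv hx
  have hleC : C ≤ cliqueUnion T {v} :=
    ⟨fun f hf => mem_cliqueUnion_singleton.2 (hmem f hf), fun f g hfg =>
      ⟨(C.adj_sub hfg).ne, v, rfl, hmem f (C.edge_vert hfg), hmem g (C.edge_vert hfg.symm)⟩⟩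
  exact le_antisymm hleC (hmax ⟨cliqueUnion_mono (Set.singleton_subset_iff.2 hv),
    cliqueUnion_singleton_connected (hmem s hs), fun _ => not_isCutVertex_cliqueUnion_singleton⟩
    hleC)

lemma mem_cliqueUnion_sdiff_singleton (hv : v ∈ R) :
    e ∈ (cliqueUnion T (R \ {v})).verts ↔
      e ∈ (cliqueUnion T R).verts ∧ ¬ (v ∈ e.1 ∧ ¬ ∀ u ∈ e.1, u ∈ R) := by
  constructor
  · rintro ⟨u, ⟨huR, huv⟩, hue⟩
    refine ⟨⟨u, huR, hue⟩, fun ⟨hve, hnot⟩ => hnot fun w hw => ?_⟩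
    rw [edge_eq_mk_of_mem hue hve huv, Sym2.mem_iff] at hw
    rcases hw with rfl | rfl <;> assumption
  · rintro ⟨⟨u, huR, hue⟩, hnot⟩
    by_cases hve : v ∈ e.1
    · obtain ⟨w, hw, hew⟩ := exists_edge_eq_mk hve
      have hwe : w ∈ e.1 := hew ▸ Sym2.mem_mk_right _ _
      exact ⟨w, ⟨not_not.1 (fun h => hnot ⟨hve, h⟩) w hwe, hw.ne'⟩, hwe⟩
    · exact ⟨u, ⟨huR, fun h => hve (h ▸ hue)⟩, hue⟩

lemma deleteVerts_deleteEdges_cliqueUnion [T.LocallyFinite] (hT : T.IsAcyclic)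
    (hR : ∀ v ∈ R, 1 < T.degree v) (hv : v ∈ R) :
    ((cliqueUnion T R).deleteEdges (cliqueUnion T {v}).edgeSet).deleteVerts
      {e | e ∈ (cliqueUnion T {v}).verts ∧ ¬ IsCutVertex (cliqueUnion T R) e} =
    cliqueUnion T (R \ {v}) := by
  have hdel : {e | e ∈ (cliqueUnion T {v}).verts ∧ ¬ IsCutVertex (cliqueUnion T R) e} =
      {e : T.edgeSet | v ∈ e.1 ∧ ¬ ∀ u ∈ e.1, u ∈ R} := by
    ext e
    rw [Set.mem_ofPred_eq, Set.mem_ofPred_eq, mem_cliqueUnion_singleton,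
      isCutVertex_cliqueUnion_iff hT hR]
  rw [hdel]
  refine Subgraph.ext (Set.ext fun e => (mem_cliqueUnion_sdiff_singleton hv).symm) ?_
  ext e f
  rw [Subgraph.deleteVerts_adj, Subgraph.deleteEdges_adj, Subgraph.mem_edgeSet]
  constructor
  · rintro ⟨-, -, -, -, ⟨hne, u, huR, hue, huf⟩, hnot⟩
    refine ⟨hne, u, ⟨huR, ?_⟩, hue, huf⟩
    rintro rfl
    exact hnot ⟨hne, u, rfl, hue, huf⟩
  · intro hef
    obtain ⟨he, he'⟩ := (mem_cliqueUnion_sdiff_singleton hv).1 (Subgraph.edge_vert _ hef)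
    obtain ⟨hf, hf'⟩ := (mem_cliqueUnion_sdiff_singleton hv).1 (Subgraph.edge_vert _ hef.symm)
    obtain ⟨hne, u, ⟨huR, huv⟩, hue, huf⟩ := hef
    refine ⟨he, he', hf, hf', ⟨hne, u, huR, hue, huf⟩, ?_⟩
    rintro ⟨-, v, rfl, hve, hvf⟩
    exact hne (edge_eq_of_mem huv hue hve huf hvf)

lemma deleteVerts_cliqueUnion [T.LocallyFinite] (hT : T.IsAcyclic)
    (hR : ∀ v ∈ R, 1 < T.degree v) (hv : v ∈ R)
    (hcut : ∀ e ∈ (cliqueUnion T {v}).verts, ¬ IsCutVertex (cliqueUnion T R) e) :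
    (cliqueUnion T R).deleteVerts (cliqueUnion T {v}).verts = cliqueUnion T (R \ {v}) := by
  have hverts : {e | e ∈ (cliqueUnion T {v}).verts ∧ ¬ IsCutVertex (cliqueUnion T R) e} =
      (cliqueUnion T {v}).verts :=
    Set.ext fun e => ⟨And.left, fun he => ⟨he, hcut e he⟩⟩
  rw [← deleteVerts_deleteEdges_cliqueUnion hT hR hv, hverts,
    deleteVerts_verts_deleteEdges_edgeSet]

end Block

/-! ### The algorithm -/

section Frontier

variable {V : Type*} {T : SimpleGraph V} {R : Set V} {a v w x : V} {e s : T.edgeSet}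

/-- The edges that lead from outside `R` down to a vertex in `R`, for the root `a`. -/
def frontier (T : SimpleGraph V) (a : V) (R : Set V) : Set T.edgeSet :=
  {e | ∃ w ∈ R, parent T a w ∉ R ∧ e.1 = s(parent T a w, w)}

lemma eq_of_mk_parent_eq (hT : T.Connected) (hv : v ≠ a) (hw : w ≠ a)
    (h : s(parent T a v, v) = s(parent T a w, w)) : v = w := by
  rcases Sym2.eq_iff.1 h with ⟨-, hvw⟩ | ⟨hpv, hpw⟩
  · exact hvw
  · have hv' := dist_eq_dist_parent_add_one hT hv
    have hw' := dist_eq_dist_parent_add_one hT hw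
    rw [hpv] at hv'
    rw [← hpw] at hw'
    omega

lemma parent_eq_of_adj (hT : T.IsTree) (h : T.Adj v w) (hne : w ≠ parent T a v) :
    w ≠ a ∧ parent T a w = v := by
  rcases eq_parent_or_eq_parent_of_adj hT a h with ⟨hw, hv⟩ | ⟨-, hw⟩
  · exact ⟨hw, hv.symm⟩
  · exact absurd hw hne

lemma val_eq_mk_parent_iff {S : Pair V} (hs : s.1 = s(parent T a v, v)) :
    S.1 = s(parent T a v, v) ↔ S = edgePair s := by
  rw [← hs, Subtype.ext_iff, edgePair]

lemma eq_mk_of_coe_eq_symmDiff {e : Sym2 V} (hxv : x ≠ v) (hxw : x ≠ w)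
    (hvw : v ≠ w) (he : (e : Set V) = symmDiff (s(x, v) : Set V) (s(v, w) : Set V)) :
    e = s(x, w) := by
  refine SetLike.coe_injective (he.trans (Set.ext fun y => ?_))
  simp only [Set.mem_symmDiff, SetLike.mem_coe, Sym2.mem_iff]
  grind

lemma exists_child_of_forall_mem (hT : T.IsTree) (hpv : parent T a v ∉ R) (hve : v ∈ e.1)
    (he : ∀ u ∈ e.1, u ∈ R) : ∃ w ∈ R, parent T a w = v ∧ e.1 = s(v, w) := by
  obtain ⟨w, hw, hew⟩ := exists_edge_eq_mk hve
  have hwR : w ∈ R := he w (hew ▸ Sym2.mem_mk_right _ _)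
  exact ⟨w, hwR, (parent_eq_of_adj hT hw (ne_of_mem_of_not_mem hwR hpv)).2, hew⟩

lemma eq_empty_of_frontier_eq_empty (hT : T.Connected) (ha : a ∉ R)
    (h : frontier T a R = ∅) : R = ∅ := by
  refine Set.eq_empty_iff_forall_notMem.2 fun x => ?_
  induction x using parent_induction (a := a) hT with
  | root => exact ha
  | step x hx ih =>
    exact fun hxR => (h ▸ Set.notMem_empty _ :
      (⟨_, adj_parent hT hx⟩ : T.edgeSet) ∉ frontier T a R) ⟨x, hxR, ih, rfl⟩

lemma frontier_sdiff_singleton (hT : T.IsTree) (ha : a ∉ R) (hv : v ∈ R)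
    (hpv : parent T a v ∉ R) (hs : s.1 = s(parent T a v, v)) :
    frontier T a (R \ {v}) = frontier T a R \ {s} ∪ {e | v ∈ e.1 ∧ ∀ u ∈ e.1, u ∈ R} := by
  have hne {u : V} (hu : u ∈ R) : u ≠ a := ne_of_mem_of_not_mem hu ha
  ext e
  constructor
  · rintro ⟨w, ⟨hw, hwv⟩, hpw, hew⟩
    by_cases hpwR : parent T a w ∈ R
    · have hpwv : parent T a w = v := by
        by_contra h
        exact hpw ⟨hpwR, h⟩
      refine Or.inr ⟨by rw [hew, hpwv]; exact Sym2.mem_mk_left _ _, fun u hu => ?_⟩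
      rw [hew, Sym2.mem_iff] at hu
      rcases hu with rfl | rfl <;> assumption
    · refine Or.inl ⟨⟨w, hw, hpwR, hew⟩, ?_⟩
      rintro rfl
      exact hwv (eq_of_mk_parent_eq hT.1 (hne hw) (hne hv) (hew.symm.trans hs))
  · rintro (⟨⟨w, hw, hpw, hew⟩, hes⟩ | ⟨hve, he⟩)
    · refine ⟨w, ⟨hw, ?_⟩, fun h => hpw h.1, hew⟩
      rintro rfl
      exact hes (Subtype.ext (hew.trans hs.symm))
    · obtain ⟨w, hw, rfl, hew⟩ := exists_child_of_forall_mem hT hpv hve he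
      exact ⟨w, ⟨hw, (parent_ne hT.1 (hne hw)).symm⟩, fun h => h.2 rfl, hew⟩

end Frontier

section State

variable {V : Type*} [Fintype V] {T : SimpleGraph V} [DecidableRel T.Adj] {R : Set V}
  {a b v : V} {s c : T.edgeSet} {N : Set T.edgeSet} {B O P : Set (Pair V)} {d : Pair V}

/-- The state of the algorithm in terms of the set `R` of inner vertices whose cliques have not
been processed: the starting edge `s` and the stored edges `N` form the frontier of `R`. -/
structure IsState (T : SimpleGraph V) [DecidableRel T.Adj] (a : V) (R : Set V) (s : T.edgeSet)
    (N : Set T.edgeSet) : Prop where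
  one_lt_degree : ∀ v ∈ R, 1 < T.degree v
  mem_of_parent_mem : ∀ w, 1 < T.degree w → parent T a w ∈ R → w ∈ R
  root_notMem : a ∉ R
  start_notMem : s ∉ N
  insert_eq_frontier : insert s N = frontier T a R

namespace IsState

lemma exists_start_eq (h : IsState T a R s N) :
    ∃ v ∈ R, parent T a v ∉ R ∧ s.1 = s(parent T a v, v) :=
  (h.insert_eq_frontier ▸ Set.mem_insert s N : s ∈ frontier T a R)

lemma sdiff_singleton (hT : T.IsTree) (h : IsState T a R s N) (hv : v ∈ R)
    (hpv : parent T a v ∉ R) (hs : s.1 = s(parent T a v, v)) {N' : Set T.edgeSet} (hc : c ∉ N')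
    (hN' : insert c N' = N ∪ {e | v ∈ e.1 ∧ ∀ u ∈ e.1, u ∈ R}) :
    IsState T a (R \ {v}) c N' where
  one_lt_degree u hu := h.one_lt_degree u hu.1
  mem_of_parent_mem u hu hpu :=
    ⟨h.mem_of_parent_mem u hu hpu.1, by rintro rfl; exact hpv hpu.1⟩
  root_notMem ha := h.root_notMem ha.1
  start_notMem := hc
  insert_eq_frontier := by
    rw [frontier_sdiff_singleton hT h.root_notMem hv hpv hs, ← h.insert_eq_frontier,
      Set.insert_sdiff_self_of_notMem h.start_notMem, hN']

lemma setOf_forall_mem_eq_empty (hT : T.IsAcyclic) (h : IsState T a R s N)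
    (hcut : ∀ e ∈ (cliqueUnion T {v}).verts, ¬ IsCutVertex (cliqueUnion T R) e) :
    {e : T.edgeSet | v ∈ e.1 ∧ ∀ u ∈ e.1, u ∈ R} = ∅ :=
  Set.eq_empty_iff_forall_notMem.2 fun e he => hcut e (mem_cliqueUnion_singleton.2 he.1)
    ((isCutVertex_cliqueUnion_iff hT h.one_lt_degree).2 he.2)

lemma descend (hT : T.IsTree) (h : IsState T a R s N) (hv : v ∈ R) (hpv : parent T a v ∉ R)
    (hs : s.1 = s(parent T a v, v)) (hvc : v ∈ c.1) (hc : ∀ u ∈ c.1, u ∈ R) :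
    IsState T a (R \ {v}) c
      (N ∪ {x | x ∈ (cliqueUnion T {v}).verts ∧ IsCutVertex (cliqueUnion T R) x ∧ x ≠ c}) := by
  have hcut (x : T.edgeSet) : IsCutVertex (cliqueUnion T R) x ↔ ∀ u ∈ x.1, u ∈ R :=
    isCutVertex_cliqueUnion_iff hT.2 h.one_lt_degree
  refine h.sdiff_singleton hT hv hpv hs ?_ ?_
  · rintro (hcN | hcc)
    · obtain ⟨w, -, hpw, hcw⟩ := h.insert_eq_frontier ▸ Set.mem_insert_of_mem s hcN
      exact hpw (hc _ (hcw ▸ Sym2.mem_mk_left _ _))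
    · exact hcc.2.2 rfl
  · ext x
    simp only [Set.mem_insert_iff, Set.mem_union, Set.mem_ofPred_eq, mem_cliqueUnion_singleton,
      hcut]
    rcases eq_or_ne x c with rfl | hxc
    · simp only [true_or, hvc, true_and, true_iff]
      exact Or.inr hc
    · simp only [hxc, false_or, ne_eq, not_false_eq_true, and_true]

lemma backtrack (hT : T.IsTree) (h : IsState T a R s N) (hv : v ∈ R) (hpv : parent T a v ∉ R)
    (hs : s.1 = s(parent T a v, v))
    (hcut : ∀ e ∈ (cliqueUnion T {v}).verts, ¬ IsCutVertex (cliqueUnion T R) e) (hc : c ∈ N) :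
    IsState T a (R \ {v}) c (N \ {c}) :=
  h.sdiff_singleton hT hv hpv hs (fun hc => hc.2 rfl) <| by
    rw [h.setOf_forall_mem_eq_empty hT.2 hcut, Set.union_empty, Set.insert_sdiff_singleton,
      Set.insert_eq_of_mem hc]

lemma eq_singleton (hT : T.IsTree) (h : IsState T a R s ∅) (hv : v ∈ R)
    (hpv : parent T a v ∉ R) (hs : s.1 = s(parent T a v, v))
    (hcut : ∀ e ∈ (cliqueUnion T {v}).verts, ¬ IsCutVertex (cliqueUnion T R) e) : R = {v} := by
  have hfrontier : frontier T a (R \ {v}) = ∅ := by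
    rw [frontier_sdiff_singleton hT h.root_notMem hv hpv hs, ← h.insert_eq_frontier,
      Set.insert_sdiff_self_of_notMem h.start_notMem, h.setOf_forall_mem_eq_empty hT.2 hcut,
      Set.union_empty]
  have hR := eq_empty_of_frontier_eq_empty hT.1 (fun ha => h.root_notMem ha.1) hfrontier
  exact (Set.sdiff_eq_empty.1 hR).antisymm (Set.singleton_subset_iff.2 hv)

lemma isSecondPair_of_forall_not_isCutVertex (hT : T.IsTree) (h : IsState T a R s N)
    (hv : v ∈ R) (hs : s.1 = s(parent T a v, v))
    (hcut : ∀ e ∈ (cliqueUnion T {v}).verts, ¬ IsCutVertex (cliqueUnion T R) e)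
    (hvc : v ∈ c.1) (hcs : c ≠ s) : IsSecondPair T a v (edgePair c) := by
  refine Or.inr ⟨?_, ?_⟩
  · rintro w hw rfl
    have hwR := h.mem_of_parent_mem w hw hv
    have hmem : (⟨_, adj_parent hT.1 (ne_of_mem_of_not_mem hwR h.root_notMem)⟩ : T.edgeSet) ∈
        {e : T.edgeSet | parent T a w ∈ e.1 ∧ ∀ u ∈ e.1, u ∈ R} :=
      ⟨Sym2.mem_mk_left _ _, fun u hu => by
        rcases Sym2.mem_iff.1 hu with rfl | rfl <;> assumption⟩
    rwa [h.setOf_forall_mem_eq_empty hT.2 hcut] at hmem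
  · obtain ⟨l, hl, hcl⟩ := exists_edge_eq_mk hvc
    obtain ⟨hla, hpl⟩ := parent_eq_of_adj hT hl (a := a) <| by
      rintro rfl
      exact hcs (Subtype.ext (hcl.trans (Sym2.eq_swap.trans hs.symm)))
    exact ⟨l, hla, hpl, hcl⟩

end IsState

lemma IsPairSystem.singleton (hs : s.1 = s(parent T a v, v)) (hd : IsSecondPair T a v d) :
    IsPairSystem T a {v} {edgePair s, d} := by
  refine ⟨fun _ => d, fun u hu => hu ▸ hd, Set.ext fun S => ?_⟩
  simp only [Set.mem_singleton_iff, exists_eq_left, Set.mem_ofPred_eq, Set.mem_insert_iff,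
    val_eq_mk_parent_iff hs]

lemma IsPairSystem.insert (hv : v ∈ R) (hs : s.1 = s(parent T a v, v))
    (hd : IsSecondPair T a v d) (hP : IsPairSystem T a (R \ {v}) P) :
    IsPairSystem T a R ({edgePair s, d} ∪ P) := by
  classical
  obtain ⟨t, ht, rfl⟩ := hP
  have hupdate {u : V} (hu : u ≠ v) : Function.update t v d u = t u := Function.update_of_ne hu d t
  have hself : Function.update t v d v = d := Function.update_self v d t
  refine ⟨Function.update t v d, fun u hu => ?_, Set.ext fun S => ⟨?_, ?_⟩⟩
  · rcases eq_or_ne u v with rfl | huv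
    · rwa [hself]
    · rw [hupdate huv]
      exact ht u ⟨hu, huv⟩
  · rintro (hS | ⟨u, ⟨hu, huv⟩, hS⟩)
    · exact ⟨v, hv, by rwa [hself, val_eq_mk_parent_iff hs]⟩
    · exact ⟨u, hu, by rwa [hupdate huv]⟩
  · rintro ⟨u, hu, hS⟩
    rcases eq_or_ne u v with rfl | huv
    · rw [hself, val_eq_mk_parent_iff hs] at hS
      exact Or.inl hS
    · exact Or.inr ⟨u, ⟨hu, huv⟩, by rwa [hupdate huv] at hS⟩

theorem AlgoReturns.exists_isPairSystem (hT : T.IsTree) {G : T.lineGraph.Subgraph}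
    (halg : AlgoReturns T G s N B O) : ∀ R, G = cliqueUnion T R → IsState T a R s N →
      ∃ P, IsPairSystem T a R P ∧ O = B ∪ P := by
  induction halg with
  | @descend G s N B O C c d hC hs hc hcut hd hO ih =>
    rintro R rfl h
    obtain ⟨v, hv, hpv, hsv⟩ := h.exists_start_eq
    obtain rfl := hC.eq_cliqueUnion_singleton hT.2 hs hsv hv hpv
    rw [mem_cliqueUnion_singleton] at hc
    rw [isCutVertex_cliqueUnion_iff hT.2 h.one_lt_degree] at hcut
    obtain ⟨P, hP, rfl⟩ := ih _ (deleteVerts_deleteEdges_cliqueUnion hT.2 h.one_lt_degree hv)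
      (h.descend hT hv hpv hsv hc hcut)
    obtain ⟨w, hwR, rfl, hcw⟩ := exists_child_of_forall_mem hT hpv hc hcut
    have hne {u : V} (hu : u ∈ R) : u ≠ a := ne_of_mem_of_not_mem hu h.root_notMem
    rw [hsv, hcw] at hd
    have hdw := eq_mk_of_coe_eq_symmDiff (parent_ne hT.1 (hne hv))
      (ne_of_mem_of_not_mem hwR hpv).symm (parent_ne hT.1 (hne hwR)) hd
    have hsecond : IsSecondPair T a (parent T a w) d :=
      Or.inl ⟨w, h.one_lt_degree w hwR, rfl, hdw⟩
    exact ⟨_, hP.insert hv hsv hsecond, Set.union_assoc _ _ _⟩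
  | @backtrack G s N B O C c w hC hs hcut hc hcs hw hO ih =>
    rintro R rfl h
    obtain ⟨v, hv, hpv, hsv⟩ := h.exists_start_eq
    obtain rfl := hC.eq_cliqueUnion_singleton hT.2 hs hsv hv hpv
    obtain ⟨P, hP, rfl⟩ := ih _ (deleteVerts_cliqueUnion hT.2 h.one_lt_degree hv hcut)
      (h.backtrack hT hv hpv hsv hcut hw)
    have hsecond := h.isSecondPair_of_forall_not_isCutVertex hT hv hsv hcut
      (mem_cliqueUnion_singleton.1 hc) hcs
    exact ⟨_, hP.insert hv hsv hsecond, Set.union_assoc _ _ _⟩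
  | @halt G s B C c hC hs hcut hc hcs =>
    rintro R rfl h
    obtain ⟨v, hv, hpv, hsv⟩ := h.exists_start_eq
    obtain rfl := hC.eq_cliqueUnion_singleton hT.2 hs hsv hv hpv
    have hsecond := h.isSecondPair_of_forall_not_isCutVertex hT hv hsv hcut
      (mem_cliqueUnion_singleton.1 hc) hcs
    obtain rfl := h.eq_singleton hT hv hpv hsv hcut
    exact ⟨_, IsPairSystem.singleton hsv hsecond, rfl⟩

lemma IsPendantEdge.top_eq_cliqueUnion (hT : T.IsTree) (h : IsPendantEdge T a b) :
    (⊤ : T.lineGraph.Subgraph) = cliqueUnion T {v | 1 < T.degree v} := by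
  refine Subgraph.ext (Set.ext fun e => ⟨fun _ => ?_, fun _ => trivial⟩) ?_
  · have hinner {u : V} (hu : u ≠ a) : ∃ w, 1 < T.degree w ∧ w ∈ s(parent T a u, u) := by
      rcases parent_eq_root_or_one_lt_degree hT.1 hu with hp | hp
      · exact ⟨b, h.one_lt_degree, h.eq_of_parent_eq_root hT.1 hu hp ▸ Sym2.mem_mk_right _ _⟩
      · exact ⟨_, hp, Sym2.mem_mk_left _ _⟩
    obtain ⟨⟨x, y⟩, hxy⟩ := e
    rcases eq_parent_or_eq_parent_of_adj hT a (T.mem_edgeSet.1 hxy) with ⟨hy, rfl⟩ | ⟨hx, rfl⟩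
    · exact hinner hy
    · obtain ⟨w, hw, hwx⟩ := hinner hx
      exact ⟨w, hw, Sym2.mem_iff.2 (Sym2.mem_iff.1 hwx).symm⟩
  · ext e f
    refine ⟨fun hef => ?_, fun hef => (cliqueUnion T _).adj_sub hef⟩
    obtain ⟨hne, v, hve, hvf⟩ := lineGraph_adj_iff_exists.1 hef
    obtain ⟨x, hx, hex⟩ := exists_edge_eq_mk hve
    obtain ⟨y, hy, hfy⟩ := exists_edge_eq_mk hvf
    refine ⟨hne, v, Finset.one_lt_card.2 ⟨x, by simpa using hx, y, by simpa using hy, ?_⟩, hve, hvf⟩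
    rintro rfl
    exact hne (Subtype.ext (hex.trans hfy.symm))

lemma IsPendantEdge.isState (hT : T.IsTree) (h : IsPendantEdge T a b) (hs : s.1 = s(a, b)) :
    IsState T a {v | 1 < T.degree v} s ∅ where
  one_lt_degree _ hv := hv
  mem_of_parent_mem _ hw _ := hw
  root_notMem ha := h.ne_root ha rfl
  start_notMem := Set.notMem_empty s
  insert_eq_frontier := by
    have hpb := h.parent_eq_root hT
    ext e
    rw [Set.mem_insert_iff, or_iff_left (Set.notMem_empty e)]
    constructor
    · rintro rfl
      exact ⟨b, h.one_lt_degree, fun hp => h.ne_root hp hpb, by rw [hpb, hs]⟩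
    · rintro ⟨w, hw, hpw, hew⟩
      have hpa := (parent_eq_root_or_one_lt_degree hT.1 (h.ne_root hw)).resolve_right hpw
      obtain rfl := h.eq_of_parent_eq_root hT.1 (h.ne_root hw) hpa
      exact Subtype.ext (by rw [hew, hpa, hs])

theorem AlgoReturns.isPairSystem (hT : T.IsTree) (h : IsPendantEdge T a b)
    (hs : s.1 = s(a, b)) (halg : AlgoReturns T ⊤ s ∅ ∅ O) :
    IsPairSystem T a {v | 1 < T.degree v} O := by
  obtain ⟨P, hP, rfl⟩ := halg.exists_isPairSystem hT _ (h.top_eq_cliqueUnion hT) (h.isState hT hs)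
  rwa [Set.empty_union]

end State

section Output

variable {V : Type*} [Fintype V] {T : SimpleGraph V} [DecidableRel T.Adj] {a b u v x : V}

lemma exists_inner_child_of_not_isStar (hT : T.IsTree) (ha : T.degree a = 1) (hab : T.Adj a b)
    (hstar : ¬ IsStar T) : ∃ w, 1 < T.degree w ∧ parent T a w = b := by
  by_contra! hno
  have hside (x : V) : x ≠ a → x = b ∨ parent T a x = b := by
    induction x using parent_induction (a := a) hT.1 with
    | root => exact fun hx => absurd rfl hx
    | step x hx ih =>
      refine fun _ => or_iff_not_imp_left.2 fun hxb => ?_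
      have hpa : parent T a x ≠ a := fun hpa =>
        hxb (eq_of_degree_eq_one ha (hpa ▸ adj_parent hT.1 hx) hab)
      exact (ih hpa).resolve_right (hno _ (one_lt_degree_parent hT.1 hx hpa))
  have hbx (x : V) (hx : b ≠ x) : T.Adj b x := by
    rcases eq_or_ne x a with rfl | hxa
    · exact hab.symm
    · exact (hside x hxa).resolve_left hx.symm ▸ adj_parent hT.1 hxa
  refine hstar ⟨b, SimpleGraph.ext (funext₂ fun x y => propext ?_)⟩
  rw [starGraph_adj]
  constructor
  · intro hxy
    refine ⟨hxy.ne, ?_⟩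
    rcases eq_parent_or_eq_parent_of_adj hT a hxy with ⟨hy, rfl⟩ | ⟨hx, rfl⟩
    · exact (hside y hy).symm
    · exact hside x hx
  · rintro ⟨hne, rfl | rfl⟩
    · exact hbx y hne
    · exact (hbx x hne.symm).symm

lemma IsSecondPair.eq_root_and_eq_base (hT : T.Connected) (h : IsPendantEdge T a b) {S : Pair V}
    (hv : 1 < T.degree v) (hS : IsSecondPair T a v S) (hSux : S.1 = s(u, x))
    (hu : T.degree u = 1) (hux : ¬ T.Adj u x) : u = a ∧ v = b := by
  rcases hS with ⟨w, hw, -, hS⟩ | ⟨-, l, hla, rfl, hS⟩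
  · rcases Sym2.eq_iff.1 (hSux.symm.trans hS) with ⟨rfl, -⟩ | ⟨rfl, -⟩
    · have hpa := (parent_eq_root_or_one_lt_degree hT (h.ne_root hv)).resolve_right hu.not_gt
      exact ⟨hpa, h.eq_of_parent_eq_root hT (h.ne_root hv) hpa⟩
    · exact absurd hu hw.ne'
  · refine absurd (T.mem_edgeSet.1 ?_) hux
    rw [← hSux, hS]
    exact adj_parent hT hla

theorem IsPairSystem.existsUnique_triple (hT : T.IsTree) (h : IsPendantEdge T a b)
    (hchild : ∃ w, 1 < T.degree w ∧ parent T a w = b) {B : Finset (Pair V)}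
    (hB : IsPairSystem T a {v | 1 < T.degree v} B) :
    ∃! t : V × V × V,
      T.degree t.1 = 1 ∧ 1 < T.degree t.2.2 ∧ T.Adj t.1 t.2.1 ∧ T.Adj t.2.1 t.2.2 ∧
      (∃ h : ¬ s(t.1, t.2.1).IsDiag, (⟨s(t.1, t.2.1), h⟩ : Pair V) ∈ B) ∧
      (∃ h : ¬ s(t.1, t.2.2).IsDiag, (⟨s(t.1, t.2.2), h⟩ : Pair V) ∈ B) := by
  obtain ⟨t, ht, hBt⟩ := hB
  have hmem (S : Pair V) :
      S ∈ B ↔ ∃ v, 1 < T.degree v ∧ (S.1 = s(parent T a v, v) ∨ S = t v) := by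
    rw [← Finset.mem_coe, hBt]
    rfl
  have hpb := h.parent_eq_root hT
  obtain ⟨w, hw, hpw, htw⟩ := (ht b h.one_lt_degree).resolve_right fun hno =>
    hchild.elim fun w hw => hno.1 w hw.1 hw.2
  have hwa := h.ne_root hw
  rw [hpb] at htw
  refine ⟨(a, b, w), ⟨h.degree_eq_one, hw, h.adj, hpw ▸ adj_parent hT.1 hwa,
    ⟨h.adj.ne, ?_⟩, ⟨hwa.symm, ?_⟩⟩, ?_⟩
  · exact (hmem _).2 ⟨b, h.one_lt_degree, Or.inl (by rw [hpb])⟩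
  · exact (hmem _).2 ⟨b, h.one_lt_degree, Or.inr (Subtype.ext htw.symm)⟩
  · rintro ⟨u, v, x⟩ ⟨hu, hx, huv, hvx, -, hne, hux⟩
    dsimp only at hu hx huv hvx hne hux
    have hnadj : ¬ T.Adj u x := fun hadj => hvx.ne (eq_of_degree_eq_one hu huv hadj)
    obtain ⟨y, hy, hS | hS⟩ := (hmem _).1 hux
    · refine absurd (T.mem_edgeSet.1 ?_) hnadj
      rw [show s(u, x) = s(parent T a y, y) from hS]
      exact adj_parent hT.1 (h.ne_root hy)
    · obtain ⟨rfl, rfl⟩ := (ht y hy).eq_root_and_eq_base hT.1 h hy (hS ▸ rfl) hu hnadj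
      rw [← hS] at htw
      rw [eq_of_degree_eq_one hu huv h.adj, Sym2.congr_right.1 htw]

variable {B : Finset (Pair V)}

theorem IsOutput.exists_isPairSystem (hT : T.IsTree) (hB : IsOutput T (B : Set (Pair V)))
    (hstar : ¬ IsStar T) :
    ∃ a b, IsPendantEdge T a b ∧ (∃ w, 1 < T.degree w ∧ parent T a w = b) ∧
      IsPairSystem T a {v | 1 < T.degree v} B := by
  rcases hB with ⟨c, -, -, -, hc, -⟩ | ⟨-, s, ⟨a, has, ha⟩, halg⟩
  · exact absurd ⟨c, hc⟩ hstar
  · obtain ⟨b, hab, hs⟩ := exists_edge_eq_mk has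
    obtain ⟨w, hw, hpw⟩ := exists_inner_child_of_not_isStar hT ha hab hstar
    have hwa : w ≠ a := by
      rintro rfl
      exact hw.ne' ha
    have h : IsPendantEdge T a b :=
      ⟨hab, ha, hpw ▸ one_lt_degree_parent hT.1 hwa (hpw ▸ hab.ne')⟩
    exact ⟨a, b, h, ⟨w, hw, hpw⟩, halg.isPairSystem hT h hs⟩

theorem IsOutput.exists_hasUnimodularFeatures [DecidableEq V] (hT : T.IsTree)
    (hB : IsOutput T (B : Set (Pair V))) :
    ∃ a b, IsPendantEdge T a b ∧ HasUnimodularFeatures T a b B := by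
  by_cases hstar : IsStar T
  · obtain ⟨c, i, j, k, rfl, hci, hcj, hck, hjk, hBpair⟩ := hB.resolve_right fun h => h.1 hstar
    have h := isPendantEdge_starGraph hcj hck hjk
    rw [← Finset.coe_pair, Finset.coe_inj] at hBpair
    exact ⟨j, c, h, hBpair ▸ hasUnimodularFeatures_of_forall_inner_eq hT h
      (fun _ => eq_center_of_one_lt_degree_starGraph) hci.symm rfl hjk.symm hck.symm rfl⟩
  · obtain ⟨a, b, h, hchild, hsys⟩ := hB.exists_isPairSystem hT hstar
    exact ⟨a, b, h, hsys.hasUnimodularFeatures hT h hchild⟩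

end Output

end Max4PC

theorem mainTheorem2 {V : Type*} [Fintype V] [DecidableEq V] (T : SimpleGraph V)
    [DecidableRel T.Adj] (hT : T.IsTree) (hn : 3 ≤ Fintype.card V)
    (B : Finset (Max4PC.Pair V)) (hB : Max4PC.IsOutput T (B : Set (Max4PC.Pair V))) :
    (¬ Max4PC.IsStar T → ∃! t : V × V × V,
      T.degree t.1 = 1 ∧ 1 < T.degree t.2.2 ∧ T.Adj t.1 t.2.1 ∧ T.Adj t.2.1 t.2.2 ∧
      (∃ h : ¬ s(t.1, t.2.1).IsDiag, (⟨s(t.1, t.2.1), h⟩ : Max4PC.Pair V) ∈ B) ∧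
      (∃ h : ¬ s(t.1, t.2.2).IsDiag, (⟨s(t.1, t.2.2), h⟩ : Max4PC.Pair V) ∈ B)) ∧
    (B.card : ℤ) = 2 * ((Fintype.card V : ℤ) - (Max4PC.numLeaves T : ℤ)) ∧
    (LinearIndependent ℝ (fun b : B => (Max4PC.max4PC T).row b.1) ∧
      Submodule.span ℝ (Set.range fun b : B => (Max4PC.max4PC T).row b.1) =
        Submodule.span ℝ (Set.range (Max4PC.max4PC T).row)) ∧
    ((Max4PC.max4PC T).submatrix (fun b : B => b.1) (fun b : B => b.1)).det =
      (-1) ^ ((Fintype.card V : ℤ) - (Max4PC.numLeaves T : ℤ)) *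
        2 ^ (2 * ((Fintype.card V : ℤ) - (Max4PC.numLeaves T : ℤ) - 1)) := by
  have : Nontrivial V := Fintype.one_lt_card_iff_nontrivial.1 (by lia)
  obtain ⟨a, b, h, hfeat⟩ := hB.exists_hasUnimodularFeatures hT
  refine ⟨fun hstar => ?_, hfeat.card_eq hT.1,
    ⟨hfeat.linearIndependent_row hT h, hfeat.span_row_eq hT h⟩, hfeat.det_submatrix hT h⟩
  obtain ⟨a, b, h, hchild, hsys⟩ := hB.exists_isPairSystem hT hstar
  exact hsys.existsUnique_triple hT h hchild
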